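/- **Theorem 1.1.** Let $\{W(t):t\ge 0\}$ be a standard Wiener process (with almost surely continuous paths), let $W_0(t)=W(t)-\int_0^1W(u)\,du$ for $t\in[0,1]$, and let $\{B(t):t\in[0,1]\}$ be a standard Brownian bridge, that is, a process with almost surely continuous paths that is equal in law to $\{W(t)-tW(1):t\in[0,1]\}$. Let $\omega_1,\omega_2,\dots$ be independent $N(0,1)$ random variables, on any probability space. Let $K(s,t)=E(W_0(s)W_0(t))$ and let $T$ be the operator $Th(t)=\int_0^1K(s,t)h(s)\,ds$ on $L^2[0,1]$. Equality in law of processes means equality of all finite-dimensional distributions. (1) The Karhunen–Loève (KL) expansion of $W_0$ is $$W_0(t)\stackrel{\text{law}}{=}\sum_{k=1}^{\infty}\omega_k\,\frac{\sqrt2\cos(k\pi t)}{k\pi}\qquad(t\in[0,1]).$$ That is: $W_0$ is a centered Gaussian process with $K\in L^2([0,1]^2)$; the functions $e_k(t)=\sqrt2\cos(k\pi t)$, $k\ge1$, are orthonormal in $L^2[0,1]$ and satisfy $Te_k=\lambda_ke_k$ with $\lambda_k=1/(k^2\pi^2)$; the sequence $\lambda_1\ge\lambda_2\ge\cdots$ lists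 all nonzero eigenvalues of $T$ with multiplicity; and for every $t\in[0,1]$ the series $\sum_k\omega_k\sqrt{\lambda_k}\,e_k(t)$ converges in mean square, its sum being, as a process in $t$, equal in law to $W_0$. (2) Consequently the nonzero eigenvalues of $T$ are exactly the numbers $1/(k^2\pi^2)$, $k\ge1$, and the eigenfunctions for $1/(k^2\pi^2)$ are exactly the functions $a\cos(k\pi t)$ with $a\ne0$ (up to almost everywhere equality). (3) The $L^2[0,1]$ norm of $W_0$ has the same law as that of $B$; moreover $\sum_{k}\omega_k^2/(k^2\pi^2)$ converges almost surely, and $$\int_0^1W_0(t)^2\,dt\stackrel{\text{law}}{=}\int_0^1B(t)^2\,dt\stackrel{\text{law}}{=}\sum_{k=1}^{\infty}\frac{\omega_k^2}{k^2\pi^2}.$$ -/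

import Mathlib

open MeasureTheory ProbabilityTheory Filter Topology unitInterval
open scoped NNReal

noncomputable section

namespace KL

/-- The mean-centered process `W₀(t) = W(t) - ∫₀¹ W(u) du`, `t ∈ [0, 1]`. -/
def meanCentered {Ω : Type*} (W : ℝ≥0 → Ω → ℝ) (t : I) (ω : Ω) : ℝ :=
  W (unitInterval.toNNReal t) ω - ∫ u : I, W (unitInterval.toNNReal u) ω

/-- The process `W(t) - t W(1)`, `t ∈ [0, 1]`. -/
def tiedDown {Ω : Type*} (W : ℝ≥0 → Ω → ℝ) (t : I) (ω : Ω) : ℝ :=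
  W (unitInterval.toNNReal t) ω - (t : ℝ) * W 1 ω

/-- Equality in law of two real processes, possibly on different probability spaces:
all finite-dimensional distributions agree. -/
def EqualInLaw {T Ω Ω' : Type*} [MeasurableSpace Ω] [MeasurableSpace Ω']
    (X : T → Ω → ℝ) (P : Measure Ω) (Y : T → Ω' → ℝ) (Q : Measure Ω') : Prop :=
  ∀ J : Finset T,
    IdentDistrib (fun ω ↦ J.restrict (X · ω)) (fun ω ↦ J.restrict (Y · ω)) P Q

/-- The covariance function `K(s, t) = E(ζ(s) ζ(t))` of a centered process. -/
def covFun {Ω : Type*} [MeasurableSpace Ω] (ζ : I → Ω → ℝ) (P : Measure Ω) (s t : I) : ℝ :=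
  ∫ ω, ζ s ω * ζ t ω ∂P

/-- The Fredholm operator `(T h)(t) = ∫₀¹ K(s, t) h(s) ds`. -/
def fredholm (K : I → I → ℝ) (h : I → ℝ) (t : I) : ℝ :=
  ∫ s : I, K s t * h s

/-- `h` is an eigenfunction in `L²[0, 1]` of the Fredholm operator with kernel `K`, for the
eigenvalue `μ`: it is square integrable, not a.e. zero, and `T h = μ h` in `L²[0, 1]`. -/
structure IsEigenfunction (K : I → I → ℝ) (μ : ℝ) (h : I → ℝ) : Prop where
  memLp : MemLp h 2 volume
  ne_zero : ¬ (∀ᵐ t : I, h t = 0)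
  eigen : ∀ᵐ t : I, fredholm K h t = μ * h t

/-- `μ` is an eigenvalue of the Fredholm operator with kernel `K` on `L²[0, 1]`. -/
def IsEigenvalue (K : I → I → ℝ) (μ : ℝ) : Prop :=
  ∃ h : I → ℝ, IsEigenfunction K μ h

/-- The process `S` is the sum of the series `∑ₖ fₖ`, converging in mean square at every time. -/
def IsMeanSquareSum {Ω : Type*} [MeasurableSpace Ω] (f : ℕ → I → Ω → ℝ) (S : I → Ω → ℝ)
    (Q : Measure Ω) : Prop :=
  (∀ k t, MemLp (f k t) 2 Q) ∧ (∀ t, MemLp (S t) 2 Q) ∧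
    ∀ t, Tendsto (fun n : ℕ ↦ ∫ ω, (S t ω - ∑ k ∈ Finset.range n, f k t ω) ^ 2 ∂Q) atTop (𝓝 0)

/-- `∑ₖ ξₖ √λₖ eₖ(t)` is the Karhunen-Loève expansion of the process `ζ`, where `ξ` is meant to be
a sequence of independent standard normal variables (indices start at `0`). -/
structure IsKLExpansion {Ω Ω' : Type*} [MeasurableSpace Ω] [MeasurableSpace Ω']
    (ζ : I → Ω → ℝ) (P : Measure Ω) (lam : ℕ → ℝ) (e : ℕ → I → ℝ)
    (ξ : ℕ → Ω' → ℝ) (Q : Measure Ω') : Prop where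
  /-- `ζ` is a Gaussian process. -/
  gaussian : IsGaussianProcess ζ P
  /-- `ζ` is centered. -/
  centered : ∀ t, ∫ ω, ζ t ω ∂P = 0
  /-- The covariance function is square integrable. -/
  cov_memLp : MemLp (fun p : I × I ↦ covFun ζ P p.1 p.2) 2 volume
  lam_nonneg : ∀ k, 0 ≤ lam k
  lam_antitone : Antitone lam
  memLp : ∀ k, MemLp (e k) 2 volume
  orthonormal : ∀ k l, ∫ t : I, e k t * e l t = if k = l then 1 else 0
  /-- Each `eₖ` is an eigenfunction for `λₖ`. -/
  eigen : ∀ k, IsEigenfunction (covFun ζ P) (lam k) (e k)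
  /-- The sequence `λₖ` lists all nonzero eigenvalues, each as often as its multiplicity: no
  eigenfunction for a nonzero eigenvalue is orthogonal to all the `eₖ`. -/
  complete : ∀ μ : ℝ, μ ≠ 0 → ∀ h : I → ℝ, IsEigenfunction (covFun ζ P) μ h →
    ∃ k, ∫ t : I, h t * e k t ≠ 0
  /-- The series converges in mean square, and its sum has the law of `ζ`. -/
  expansion : ∃ S : I → Ω' → ℝ,
    IsMeanSquareSum (fun k t ω ↦ ξ k ω * √(lam k) * e k t) S Q ∧ EqualInLaw ζ P S Q

/-- The `L²[0, 1]` norm of the path of `ζ`. -/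
def pathL2Norm {Ω : Type*} (ζ : I → Ω → ℝ) (ω : Ω) : ℝ :=
  √(∫ t : I, ζ t ω ^ 2)

end KL

end

/-! Both `W₀` and `B` are centered Gaussian processes, so their laws are determined by their
covariances. Let `C(y) = ∑ cos(kπy) / (k²π²)`, which on `[0, 2]` is the Bernoulli polynomial `y²/4 -
y/2 + 1/6`. Then `C(|s - t|) + C(s + t)` is the covariance of `W₀` and `C(|s - t|) - C(s + t)` is
that of the bridge. By the product-to-sum formulas these are Mercer expansions with the same
eigenvalues, in `√2 cos(kπt)` and in `√2 sin(kπt)` (`isMercer_cosSystem`, `isMercer_sinSystem`).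

A Mercer expansion gives `T h = ∑ λₖ ⟨h, eₖ⟩ eₖ` pointwise (`IsMercer.hasSum_fredholm`), from which
the spectrum is read off without any completeness of the system in `L²`. The random series converges
in mean square to a Gaussian process with the same covariance, hence the same law
(`isCenteredGaussian_series`).

For the `L²` norm, the sum `S` of the random series has no known path regularity, so `∫ S²` is
avoided. Quadrature sums of squares depend on finitely many times, hence have the same law for `S`
as for the process. They converge to `∫ X²` by path continuity, and to `∑ λₖ ξₖ²` in probability
(`tendstoInMeasure_quadrature_sq`). The limit law depends on the eigenvalues only, so it is the same
for `W₀` and `B`. -/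

namespace KL

/-! ### Centered Gaussian processes and their laws -/

/-- `X` is a centered Gaussian process with covariance function `K`. -/
structure IsCenteredGaussian {T Ω : Type*} [MeasurableSpace Ω] (X : T → Ω → ℝ) (K : T → T → ℝ)
    (P : Measure Ω) : Prop where
  gaussian : IsGaussianProcess X P
  mean : ∀ t, ∫ ω, X t ω ∂P = 0
  cov : ∀ s t, ∫ ω, X s ω * X t ω ∂P = K s t

namespace IsCenteredGaussian

variable {T Ω : Type*} [MeasurableSpace Ω] {X : T → Ω → ℝ} {K : T → T → ℝ} {P : Measure Ω}

lemma memLp (hX : IsCenteredGaussian X K P) (t : T) : MemLp (X t) 2 P :=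
  (hX.gaussian.hasGaussianLaw_eval t).memLp_two

lemma integrable_mul (hX : IsCenteredGaussian X K P) (s t : T) :
    Integrable (fun ω ↦ X s ω * X t ω) P :=
  (hX.memLp s).integrable_mul (hX.memLp t)

lemma symm (hX : IsCenteredGaussian X K P) (s t : T) : K s t = K t s := by
  simp_rw [← hX.cov, mul_comm]

lemma integral_sum_mul_sum (hX : IsCenteredGaussian X K P) {ι κ : Type*} [Fintype ι] [Fintype κ]
    (s : ι → T) (a : ι → ℝ) (t : κ → T) (b : κ → ℝ) :
    ∫ ω, (∑ i, a i * X (s i) ω) * (∑ j, b j * X (t j) ω) ∂P =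
      ∑ i, ∑ j, a i * b j * K (s i) (t j) := by
  have h (i : ι) (j : κ) (ω : Ω) : a i * X (s i) ω * (b j * X (t j) ω) =
      a i * b j * (X (s i) ω * X (t j) ω) := by ring
  simp_rw [Finset.sum_mul_sum, h]
  rw [integral_finsetSum _ fun i _ ↦ integrable_finsetSum _ fun j _ ↦
    (hX.integrable_mul _ _).const_mul _]
  refine Finset.sum_congr rfl fun i _ ↦ ?_
  rw [integral_finsetSum _ fun j _ ↦ (hX.integrable_mul _ _).const_mul _]
  simp_rw [integral_const_mul, hX.cov]

lemma integral_sum (hX : IsCenteredGaussian X K P) {ι : Type*} [Fintype ι]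
    (s : ι → T) (a : ι → ℝ) : ∫ ω, ∑ i, a i * X (s i) ω ∂P = 0 := by
  rw [integral_finsetSum _ fun i _ ↦ ((hX.gaussian.hasGaussianLaw_eval _).integrable).const_mul _]
  simp [integral_const_mul, hX.mean]

/-- Finite linear combinations of a centered Gaussian process. -/
lemma linear (hX : IsCenteredGaussian X K P) {S : Type*} {ι : S → Type*} [∀ u, Fintype (ι u)]
    (s : ∀ u, ι u → T) (a : ∀ u, ι u → ℝ) :
    IsCenteredGaussian (fun u ω ↦ ∑ i, a u i * X (s u i) ω)
      (fun u v ↦ ∑ i, ∑ j, a u i * a v j * K (s u i) (s v j)) P where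
  gaussian := by
    classical
    refine hX.gaussian.of_isGaussianProcess fun u ↦ ⟨Finset.univ.image (s u),
      ∑ i, a u i • ContinuousLinearMap.proj (⟨s u i, by simp⟩ : Finset.univ.image (s u)), ?_⟩
    intro ω
    simp
  mean u := hX.integral_sum _ _
  cov u v := hX.integral_sum_mul_sum _ _ _ _

lemma quadForm_nonneg (hX : IsCenteredGaussian X K P) {ι : Type*} [Fintype ι]
    (s : ι → T) (a : ι → ℝ) : 0 ≤ ∑ i, ∑ j, a i * a j * K (s i) (s j) := by
  rw [← hX.integral_sum_mul_sum s a s a]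
  exact integral_nonneg fun ω ↦ mul_self_nonneg _

lemma hasLaw (hX : IsCenteredGaussian X K P) (t : T) :
    HasLaw (X t) (gaussianReal 0 (K t t).toNNReal) P where
  aemeasurable := hX.gaussian.aemeasurable t
  map_eq := by
    have := hX.gaussian.isProbabilityMeasure
    have hg := hX.gaussian.hasGaussianLaw_eval t
    rw [IsGaussian.eq_gaussianReal _ hg.isGaussian_map,
      variance_map aemeasurable_id (hX.gaussian.aemeasurable t), Function.id_comp,
      variance_of_integral_eq_zero (hX.gaussian.aemeasurable t) (hX.mean t),
      integral_map (hX.gaussian.aemeasurable t) (by fun_prop), ← hX.cov t t]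
    simp [hX.mean t, pow_two]

lemma hasLaw_sum (hX : IsCenteredGaussian X K P) {ι : Type*} [Fintype ι]
    (s : ι → T) (a : ι → ℝ) : HasLaw (fun ω ↦ ∑ i, a i * X (s i) ω)
      (gaussianReal 0 (∑ i, ∑ j, a i * a j * K (s i) (s j)).toNNReal) P :=
  (hX.linear (S := Unit) (ι := fun _ ↦ ι) (fun _ ↦ s) (fun _ ↦ a)).hasLaw ()

end IsCenteredGaussian

lemma exists_dual_apply_restrict {T : Type*} (J : Finset T) (L : StrongDual ℝ (J → ℝ)) :
    ∃ a : J → ℝ, ∀ x : T → ℝ, L (J.restrict x) = ∑ i : J, a i * x i := by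
  classical
  refine ⟨fun i ↦ L (Pi.single i 1), fun x ↦ ?_⟩
  have h : J.restrict x = ∑ i : J, x i • (Pi.single i 1 : J → ℝ) := by
    ext j
    simp [Finset.sum_apply, Pi.single_apply]
  rw [h, map_sum]
  simp [mul_comm]

lemma aemeasurable_restrict {T Ω : Type*} [MeasurableSpace Ω] {X : T → Ω → ℝ} {P : Measure Ω}
    (hX : ∀ t, AEMeasurable (X t) P) (J : Finset T) :
    AEMeasurable (fun ω ↦ J.restrict (X · ω)) P :=
  aemeasurable_pi_lambda _ fun i ↦ hX i

/-- Two centered Gaussian processes with the same covariance function have the same law. -/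
lemma IsCenteredGaussian.equalInLaw {T Ω Ω' : Type*} [MeasurableSpace Ω] [MeasurableSpace Ω']
    {X : T → Ω → ℝ} {Y : T → Ω' → ℝ} {K : T → T → ℝ} {P : Measure Ω} {Q : Measure Ω'}
    (hX : IsCenteredGaussian X K P) (hY : IsCenteredGaussian Y K Q) : EqualInLaw X P Y Q := by
  intro J
  have := hX.gaussian.isProbabilityMeasure
  have := hY.gaussian.isProbabilityMeasure
  have hXm := aemeasurable_restrict hX.gaussian.aemeasurable J
  have hYm := aemeasurable_restrict hY.gaussian.aemeasurable J
  refine ⟨hXm, hYm, ?_⟩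
  -- Cramér–Wold: a linear functional of the restriction is a combination of coordinates, and its
  -- Gaussian law depends on `K` alone.
  refine Measure.ext_of_charFunDual (funext fun L ↦ ?_)
  rw [charFunDual_eq_charFun_map_one, charFunDual_eq_charFun_map_one,
    AEMeasurable.map_map_of_aemeasurable (by fun_prop) hXm,
    AEMeasurable.map_map_of_aemeasurable (by fun_prop) hYm]
  obtain ⟨a, ha⟩ := exists_dual_apply_restrict J L
  simp only [Function.comp_def, ha, (hX.hasLaw_sum (fun i : J ↦ (i : T)) a).map_eq,
    (hY.hasLaw_sum (fun i : J ↦ (i : T)) a).map_eq]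

/-! ### Limits in probability of Gaussian variables and processes -/

/-- A limit in probability of centered real Gaussian variables is Gaussian. -/
lemma hasLaw_gaussianReal_of_tendstoInMeasure {Ω : Type*} [MeasurableSpace Ω] {P : Measure Ω}
    [IsProbabilityMeasure P] {Y : ℕ → Ω → ℝ} {Z : Ω → ℝ} {v : ℕ → ℝ≥0} {w : ℝ≥0}
    (hY : ∀ n, HasLaw (Y n) (gaussianReal 0 (v n)) P) (hv : Tendsto v atTop (𝓝 w))
    (hYZ : TendstoInMeasure P Y atTop Z) : HasLaw Z (gaussianReal 0 w) P := by
  have hZ : AEMeasurable Z P := hYZ.aemeasurable fun n ↦ (hY n).aemeasurable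
  refine ⟨hZ, ?_⟩
  have := Measure.isProbabilityMeasure_map (μ := P) hZ
  refine Measure.ext_of_charFun (funext fun u ↦ ?_)
  have h1 := (ProbabilityMeasure.tendsto_iff_tendsto_charFun.1
    (hYZ.tendstoInDistribution fun n ↦ (hY n).aemeasurable).tendsto) u
  simp only [ProbabilityMeasure.coe_mk, (hY _).map_eq, charFun_gaussianReal] at h1
  rw [charFun_gaussianReal]
  refine tendsto_nhds_unique h1 ?_
  have hv' : Tendsto (fun n ↦ ((v n : ℝ) : ℂ)) atTop (𝓝 ((w : ℝ) : ℂ)) :=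
    (Complex.continuous_ofReal.tendsto _).comp ((NNReal.continuous_coe.tendsto _).comp hv)
  exact (Complex.continuous_exp.tendsto _).comp
    (tendsto_const_nhds.sub ((hv'.mul_const _).div_const _))

lemma tendstoInMeasure_const_mul {Ω : Type*} [MeasurableSpace Ω] {P : Measure Ω}
    {Y : ℕ → Ω → ℝ} {Z : Ω → ℝ} (c : ℝ) (h : TendstoInMeasure P Y atTop Z) :
    TendstoInMeasure P (fun n ω ↦ c * Y n ω) atTop (fun ω ↦ c * Z ω) := by
  rw [tendstoInMeasure_iff_dist] at h ⊢
  intro ε hε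
  rcases eq_or_ne c 0 with rfl | hc
  · simp [hε.not_ge]
  · have hc' := abs_pos.2 hc
    convert h (ε / |c|) (by positivity) using 5 with n ω
    rw [Real.dist_eq, Real.dist_eq, ← mul_sub, abs_mul, div_le_iff₀' hc']

lemma tendstoInMeasure_add {Ω : Type*} [MeasurableSpace Ω] {P : Measure Ω}
    {Y Y' : ℕ → Ω → ℝ} {Z Z' : Ω → ℝ} (h : TendstoInMeasure P Y atTop Z)
    (h' : TendstoInMeasure P Y' atTop Z') :
    TendstoInMeasure P (fun n ω ↦ Y n ω + Y' n ω) atTop (fun ω ↦ Z ω + Z' ω) := by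
  rw [tendstoInMeasure_iff_dist] at h h' ⊢
  intro ε hε
  have h0 := (h (ε / 2) (half_pos hε)).add (h' (ε / 2) (half_pos hε))
  rw [add_zero] at h0
  refine tendsto_of_tendsto_of_tendsto_of_le_of_le tendsto_const_nhds h0 (fun _ ↦ zero_le)
    fun n ↦ (measure_mono fun ω hω ↦ ?_).trans (measure_union_le _ _)
  by_contra hcon
  simp only [Set.mem_union, Set.mem_ofPred_eq, not_or, not_le] at hcon hω
  linarith [dist_add_add_le (Y n ω) (Y' n ω) (Z ω) (Z' ω)]

lemma tendstoInMeasure_sum {Ω ι : Type*} [MeasurableSpace Ω] {P : Measure Ω}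
    {Y : ι → ℕ → Ω → ℝ} {Z : ι → Ω → ℝ} (s : Finset ι)
    (h : ∀ i ∈ s, TendstoInMeasure P (Y i) atTop (Z i)) :
    TendstoInMeasure P (fun n ω ↦ ∑ i ∈ s, Y i n ω) atTop (fun ω ↦ ∑ i ∈ s, Z i ω) := by
  classical
  induction s using Finset.induction_on with
  | empty =>
    rw [tendstoInMeasure_iff_dist]
    intro ε hε
    simp [hε.not_ge]
  | insert i s hi ih =>
    simp_rw [Finset.sum_insert hi]
    exact tendstoInMeasure_add (h i (by simp)) (ih fun j hj ↦ h j (by simp [hj]))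

/-- A limit in probability of centered Gaussian processes whose covariances converge is a centered
Gaussian process. -/
lemma IsCenteredGaussian.of_tendstoInMeasure {T Ω : Type*} [MeasurableSpace Ω] {P : Measure Ω}
    {X : ℕ → T → Ω → ℝ} {Y : T → Ω → ℝ} {K : ℕ → T → T → ℝ} {K' : T → T → ℝ}
    (hX : ∀ n, IsCenteredGaussian (X n) (K n) P)
    (hK : ∀ s t, Tendsto (fun n ↦ K n s t) atTop (𝓝 (K' s t)))
    (hXY : ∀ t, TendstoInMeasure P (fun n ↦ X n t) atTop (Y t)) : IsCenteredGaussian Y K' P := by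
  have := (hX 0).gaussian.isProbabilityMeasure
  -- The nonnegativity makes `toNNReal` harmless when variances are read back as real numbers.
  have key {ι : Type} [Fintype ι] (s : ι → T) (a : ι → ℝ) :
      HasLaw (fun ω ↦ ∑ i, a i * Y (s i) ω)
        (gaussianReal 0 (∑ i, ∑ j, a i * a j * K' (s i) (s j)).toNNReal) P ∧
      0 ≤ ∑ i, ∑ j, a i * a j * K' (s i) (s j) := by
    have hlim : Tendsto (fun n ↦ ∑ i, ∑ j, a i * a j * K n (s i) (s j)) atTop
        (𝓝 (∑ i, ∑ j, a i * a j * K' (s i) (s j))) :=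
      tendsto_finsetSum _ fun i _ ↦ tendsto_finsetSum _ fun j _ ↦ (hK _ _).const_mul _
    exact ⟨hasLaw_gaussianReal_of_tendstoInMeasure (fun n ↦ (hX n).hasLaw_sum s a)
      ((continuous_real_toNNReal.tendsto _).comp hlim)
      (tendstoInMeasure_sum _ fun i _ ↦ tendstoInMeasure_const_mul _ (hXY _)),
      ge_of_tendsto' hlim fun n ↦ (hX n).quadForm_nonneg s a⟩
  have hK'symm (s t : T) : K' s t = K' t s :=
    tendsto_nhds_unique (hK s t) ((hK t s).congr fun n ↦ (hX n).symm t s)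
  have hone (t : T) : HasLaw (Y t) (gaussianReal 0 (K' t t).toNNReal) P ∧ 0 ≤ K' t t := by
    simpa using key (fun _ : Unit ↦ t) (fun _ ↦ 1)
  have hmemLp (t : T) : MemLp (Y t) 2 P := (hone t).1.hasGaussianLaw.memLp_two
  have hsq {Z : Ω → ℝ} {v : ℝ} (h : HasLaw Z (gaussianReal 0 v.toNNReal) P ∧ 0 ≤ v) :
      ∫ ω, Z ω ^ 2 ∂P = v := by
    have hm : ∫ ω, Z ω ∂P = 0 := by rw [h.1.integral_eq]; exact integral_id_gaussianReal
    rw [← variance_of_integral_eq_zero h.1.aemeasurable hm, h.1.variance_eq,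
      variance_id_gaussianReal, Real.coe_toNNReal _ h.2]
  refine ⟨⟨fun J ↦ ⟨isGaussian_of_map_eq_gaussianReal fun L ↦ ?_⟩⟩, fun t ↦ ?_, fun s t ↦ ?_⟩
  · have hm := aemeasurable_restrict (fun t ↦ (hone t).1.aemeasurable) J
    rw [AEMeasurable.map_map_of_aemeasurable (by fun_prop) hm]
    obtain ⟨a, ha⟩ := exists_dual_apply_restrict J L
    simp only [Function.comp_def, ha]
    -- `key` takes index types in `Type`, while `J` lives in the universe of `T`; hence the
    -- reindexing by `Fin`.
    let e := J.equivFin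
    have h := (key (fun i ↦ (e.symm i : T)) (fun i ↦ a (e.symm i))).1
    refine ⟨_, _, Eq.trans ?_ h.map_eq⟩
    congr 1
    ext ω
    exact (Equiv.sum_comp e.symm fun i : J ↦ a i * Y i ω).symm
  · rw [(hone t).1.integral_eq]
    exact integral_id_gaussianReal
  · have h2 := hsq (key (fun b : Bool ↦ if b then s else t) (fun _ ↦ 1))
    have hs := hsq (hone s)
    have ht := hsq (hone t)
    have hexp (ω : Ω) : (∑ b : Bool, 1 * Y (if b then s else t) ω) ^ 2 =
        Y s ω ^ 2 + 2 * (Y s ω * Y t ω) + Y t ω ^ 2 := by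
      simp; ring
    have hst : Integrable (fun ω ↦ Y s ω * Y t ω) P := (hmemLp s).integrable_mul (hmemLp t)
    simp_rw [hexp] at h2
    have hadd : Integrable (fun ω ↦ Y s ω ^ 2 + 2 * (Y s ω * Y t ω)) P :=
      (hmemLp s).integrable_sq.add (hst.const_mul 2)
    rw [integral_add hadd (hmemLp t).integrable_sq,
      integral_add (hmemLp s).integrable_sq (hst.const_mul 2), integral_const_mul, hs, ht] at h2
    simp at h2
    linarith [hK'symm s t]

/-! ### Quadrature on the unit interval -/

lemma integral_unitInterval (f : ℝ → ℝ) : ∫ t : I, f t = ∫ x in (0 : ℝ)..1, f x := by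
  rw [intervalIntegral.integral_of_le zero_le_one, ← integral_Icc_eq_integral_Ioc]
  exact integral_subtype measurableSet_Icc f

/-- Simple functions converging pointwise to the identity of the unit interval. -/
noncomputable def nodes (n : ℕ) : SimpleFunc I I :=
  SimpleFunc.approxOn id measurable_id Set.univ 0 (Set.mem_univ 0) n

/-- The weight of the point `x` in the quadrature formula. -/
noncomputable def weight (n : ℕ) (x : I) : ℝ := volume.real (nodes n ⁻¹' {x})

/-- A quadrature formula on the unit interval. -/
noncomputable def quadrature (n : ℕ) (g : I → ℝ) : ℝ := ∑ x ∈ (nodes n).range, weight n x * g x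

lemma weight_nonneg (n : ℕ) (x : I) : 0 ≤ weight n x := measureReal_nonneg

lemma tendsto_nodes (t : I) : Tendsto (fun n ↦ nodes n t) atTop (𝓝 t) :=
  SimpleFunc.tendsto_approxOn measurable_id (Set.mem_univ 0) (by simp)

/-- `nodes n` is a simple function, so the finite sum is an integral grouped by fibres. Limits of
quadratures thereby reduce to dominated convergence. -/
lemma quadrature_eq_integral (n : ℕ) (g : I → ℝ) : quadrature n g = ∫ t, g (nodes n t) := by
  have h (t : I) : g (nodes n t) =
      ∑ x ∈ (nodes n).range, (nodes n ⁻¹' {x}).indicator (fun _ ↦ g x) t := by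
    rw [Finset.sum_eq_single (nodes n t)]
    · simp
    · intro x _ hx
      simp [hx.symm]
    · intro hx
      exact absurd ((nodes n).mem_range_self t) hx
  simp_rw [h]
  rw [integral_finsetSum _ fun x _ ↦
    (integrable_const _).indicator ((nodes n).measurableSet_fiber x)]
  simp_rw [integral_indicator_const _ ((nodes n).measurableSet_fiber _)]
  rfl

lemma quadrature_one (n : ℕ) : quadrature n (fun _ ↦ 1) = 1 := by
  simp [quadrature_eq_integral]

lemma sum_weight (n : ℕ) : ∑ x ∈ (nodes n).range, weight n x = 1 := by
  simpa [quadrature] using quadrature_one n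

lemma tendsto_quadrature {g : I → ℝ} (hg : Continuous g) :
    Tendsto (fun n ↦ quadrature n g) atTop (𝓝 (∫ t, g t)) := by
  simp_rw [quadrature_eq_integral]
  obtain ⟨C, hC⟩ := isCompact_univ.exists_bound_of_continuousOn hg.continuousOn
  exact tendsto_integral_of_dominated_convergence (fun _ ↦ C)
    (fun n ↦ ((nodes n).map g).stronglyMeasurable.aestronglyMeasurable) (integrable_const _)
    (fun n ↦ ae_of_all _ fun t ↦ hC _ (Set.mem_univ _))
    (ae_of_all _ fun t ↦ (hg.tendsto _).comp (tendsto_nodes t))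

lemma tendsto_quadrature_quadrature {g : I → I → ℝ} (hg : Continuous (Function.uncurry g)) :
    Tendsto (fun n ↦ quadrature n fun x ↦ quadrature n (g x)) atTop (𝓝 (∫ s, ∫ t, g s t)) := by
  simp_rw [quadrature_eq_integral]
  obtain ⟨C, hC⟩ := isCompact_univ.exists_bound_of_continuousOn hg.continuousOn
  have hC' (s t : I) : ‖g s t‖ ≤ C := hC (s, t) (Set.mem_univ _)
  refine tendsto_integral_of_dominated_convergence (fun _ ↦ C) (fun n ↦
    ((nodes n).map fun x ↦ ∫ t, g x (nodes n t)).stronglyMeasurable.aestronglyMeasurable)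
    (integrable_const _) (fun n ↦ ae_of_all _ fun s ↦ ?_) (ae_of_all _ fun s ↦ ?_)
  · refine (norm_integral_le_of_norm_le_const (ae_of_all _ fun t ↦ hC' _ _)).trans ?_
    simp
  · exact tendsto_integral_of_dominated_convergence (fun _ ↦ C)
      (fun n ↦ ((nodes n).map (g (nodes n s))).stronglyMeasurable.aestronglyMeasurable)
      (integrable_const _) (fun n ↦ ae_of_all _ fun t ↦ hC' _ _)
      (ae_of_all _ fun t ↦ (hg.tendsto (s, t)).comp
        ((tendsto_nodes s).prodMk_nhds (tendsto_nodes t)))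

lemma integral_min (s : I) : ∫ u : I, min (s : ℝ) u = s - (s : ℝ) ^ 2 / 2 := by
  rw [integral_unitInterval (fun x ↦ min (s : ℝ) x),
    ← intervalIntegral.integral_add_adjacent_intervals (b := (s : ℝ))
      (Continuous.intervalIntegrable (by fun_prop) _ _)
      (Continuous.intervalIntegrable (by fun_prop) _ _)]
  have h1 : ∫ x in (0 : ℝ)..s, min (s : ℝ) x = ∫ x in (0 : ℝ)..s, x :=
    intervalIntegral.integral_congr fun x hx ↦ by
      rw [Set.uIcc_of_le s.2.1] at hx
      exact min_eq_right hx.2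
  have h2 : ∫ x in (s : ℝ)..1, min (s : ℝ) x = ∫ x in (s : ℝ)..1, (s : ℝ) :=
    intervalIntegral.integral_congr fun x hx ↦ by
      rw [Set.uIcc_of_le s.2.2] at hx
      exact min_eq_left hx.1
  rw [h1, h2, integral_id, intervalIntegral.integral_const, smul_eq_mul]
  ring

lemma integral_integral_min : ∫ s : I, ∫ u : I, min (s : ℝ) u = 1 / 3 := by
  simp_rw [integral_min]
  rw [integral_unitInterval (fun x ↦ x - x ^ 2 / 2), intervalIntegral.integral_sub
    (Continuous.intervalIntegrable (by fun_prop) _ _)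
    (Continuous.intervalIntegrable (by fun_prop) _ _), intervalIntegral.integral_div]
  norm_num

/-! ### Covariances of the bridge and of the mean-centered Wiener process -/

section Wiener

variable {Ω : Type*} [MeasurableSpace Ω] {P : Measure Ω} {W : ℝ≥0 → Ω → ℝ}

lemma isCenteredGaussian_of_isBrownianReal (hW : IsBrownianReal W P) :
    IsCenteredGaussian (fun (t : I) ↦ W (toNNReal t)) (fun s t ↦ min (s : ℝ) t) P where
  gaussian := hW.isGaussianProcess.comp_right toNNReal
  mean t := hW.integral_eval _
  cov s t := by
    have := hW.isGaussianProcess.isProbabilityMeasure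
    have h := hW.covariance_eval (toNNReal s) (toNNReal t)
    rw [covariance_eq_sub (hW.isGaussianProcess.hasGaussianLaw_eval _).memLp_two
      (hW.isGaussianProcess.hasGaussianLaw_eval _).memLp_two, hW.integral_eval, zero_mul,
      sub_zero] at h
    simpa using h

lemma isCenteredGaussian_tiedDown (hW : IsBrownianReal W P) :
    IsCenteredGaussian (tiedDown W) (fun s t ↦ min (s : ℝ) t - s * t) P := by
  have h := (isCenteredGaussian_of_isBrownianReal hW).linear (S := I) (ι := fun _ ↦ Bool)
    (fun t b ↦ if b then t else 1) (fun t b ↦ if b then 1 else -(t : ℝ))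
  convert h using 1
  · ext t ω
    have h1 : toNNReal (1 : I) = 1 := rfl
    simp [tiedDown, h1]
    ring
  · ext s t
    simp [s.2.2, t.2.2]
    ring

/-- The covariance function of the mean-centered Wiener process. -/
noncomputable def centeredKernel (s t : I) : ℝ :=
  min (s : ℝ) t - (s - (s : ℝ) ^ 2 / 2) - (t - (t : ℝ) ^ 2 / 2) + 1 / 3

/-- `∫ W` is not a finite combination of values of `W`. Quadrature sums are, and they converge to it
almost surely by path continuity, while their covariances converge to integrals of `min`. -/
lemma isCenteredGaussian_meanCentered (hW : IsBrownianReal W P) :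
    IsCenteredGaussian (meanCentered W) centeredKernel P := by
  have := hW.isGaussianProcess.isProbabilityMeasure
  have hB := isCenteredGaussian_of_isBrownianReal hW
  refine IsCenteredGaussian.of_tendstoInMeasure
    (X := fun n t ω ↦ W (toNNReal t) ω - quadrature n fun u ↦ W (toNNReal u) ω)
    (K := fun n s t ↦ min (s : ℝ) t - quadrature n (fun u : I ↦ min (s : ℝ) u) -
      quadrature n (fun u : I ↦ min (t : ℝ) u) +
      quadrature n fun u : I ↦ quadrature n fun v : I ↦ min (u : ℝ) v)
    (fun n ↦ ?_) (fun s t ↦ ?_) (fun t ↦ ?_)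
  -- `none` carries `W t` with coefficient `1`; `some x` carries the node `x` with its negated
  -- weight.
  · have h := hB.linear (S := I) (ι := fun _ ↦ Option (nodes n).range)
      (fun t o ↦ o.elim t (fun x ↦ x)) (fun t o ↦ o.elim 1 (fun x ↦ -weight n x))
    convert h using 1
    · ext t ω
      simp [quadrature, Finset.sum_attach (nodes n).range (fun x ↦ weight n x * W (toNNReal x) ω),
        sub_eq_add_neg]
    · ext s t
      have h1 (f : I → ℝ) : ∑ i : (nodes n).range, weight n i * f i = quadrature n f :=
        Finset.sum_attach (nodes n).range (fun x ↦ weight n x * f x)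
      simp only [Fintype.sum_option, Option.elim]
      have e1 : ∑ x : (nodes n).range, 1 * -weight n x * min (s : ℝ) (x : I) =
          -quadrature n fun u : I ↦ min (s : ℝ) u := by
        rw [← h1, ← Finset.sum_neg_distrib]
        exact Finset.sum_congr rfl fun x _ ↦ by ring
      have e2 (x : (nodes n).range) :
          ∑ y : (nodes n).range, -weight n x * -weight n y * min ((x : I) : ℝ) (y : I) =
          weight n x * quadrature n fun v : I ↦ min ((x : I) : ℝ) v := by
        rw [← h1, Finset.mul_sum]
        exact Finset.sum_congr rfl fun y _ ↦ by ring
      have e3 : ∑ x : (nodes n).range, -weight n x * 1 * min ((x : I) : ℝ) t =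
          -quadrature n fun u : I ↦ min (t : ℝ) u := by
        rw [← h1, ← Finset.sum_neg_distrib]
        exact Finset.sum_congr rfl fun x _ ↦ by rw [min_comm]; ring
      rw [e1, Finset.sum_add_distrib, e3]
      simp_rw [e2]
      rw [h1 fun u ↦ quadrature n fun v : I ↦ min (u : ℝ) v]
      ring
  · refine Tendsto.add ((tendsto_const_nhds.sub ?_).sub ?_) ?_
    · rw [← integral_min]
      exact tendsto_quadrature (by fun_prop)
    · rw [← integral_min]
      exact tendsto_quadrature (by fun_prop)
    · rw [← integral_integral_min]
      exact tendsto_quadrature_quadrature (g := fun u v : I ↦ min (u : ℝ) v)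
        (by unfold Function.uncurry; fun_prop)
  · refine tendstoInMeasure_of_tendsto_ae (fun n ↦ ?_) ?_
    · refine AEMeasurable.aestronglyMeasurable ((hW.aemeasurable _).sub ?_)
      unfold quadrature
      exact Finset.aemeasurable_fun_sum _ fun x _ ↦ (hW.aemeasurable _).const_mul _
    · filter_upwards [hW.cont] with ω hω
      exact tendsto_const_nhds.sub (tendsto_quadrature (by fun_prop))

end Wiener

/-! ### Mercer expansions of the two covariances -/

/-- A bounded continuous orthonormal system `e` on the unit interval, with summable weights `lam`,
for which Mercer's expansion `K(s, t) = ∑ₖ λₖ eₖ(s) eₖ(t)` holds. -/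
structure IsMercer (K : I → I → ℝ) (lam : ℕ → ℝ) (e : ℕ → I → ℝ) : Prop where
  continuous : ∀ k, Continuous (e k)
  sq_le : ∀ k t, e k t ^ 2 ≤ 2
  orthonormal : ∀ k l, ∫ t : I, e k t * e l t = if k = l then 1 else 0
  lam_nonneg : ∀ k, 0 ≤ lam k
  summable : Summable lam
  hasSum : ∀ s t, HasSum (fun k ↦ lam k * (e k s * e k t)) (K s t)

/-- The numbers `1 / (k² π²)`, indexed from `0`. -/
noncomputable def harmonicEigenvalue (k : ℕ) : ℝ := 1 / (((k : ℝ) + 1) ^ 2 * Real.pi ^ 2)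

/-- The functions `√2 cos(k π t)`, indexed from `0`. -/
noncomputable def cosSystem (k : ℕ) (t : I) : ℝ :=
  √2 * Real.cos (((k : ℝ) + 1) * Real.pi * (t : ℝ))

/-- The functions `√2 sin(k π t)`, indexed from `0`. -/
noncomputable def sinSystem (k : ℕ) (t : I) : ℝ :=
  √2 * Real.sin (((k : ℝ) + 1) * Real.pi * (t : ℝ))

lemma harmonicEigenvalue_pos (k : ℕ) : 0 < harmonicEigenvalue k := by
  unfold harmonicEigenvalue; positivity

lemma strictAnti_harmonicEigenvalue : StrictAnti harmonicEigenvalue := by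
  intro k l hkl
  unfold harmonicEigenvalue
  have : (k : ℝ) < l := by exact_mod_cast hkl
  gcongr

/-- This is the Fourier series of the Bernoulli polynomial `B₂` on `[0, 1]`, taken at `y / 2`; the
range `[0, 2]` is what `s + t` needs. -/
lemma hasSum_harmonicEigenvalue_mul_cos {y : ℝ} (hy0 : 0 ≤ y) (hy2 : y ≤ 2) :
    HasSum (fun k : ℕ ↦ harmonicEigenvalue k * Real.cos (((k : ℝ) + 1) * Real.pi * y))
      (y ^ 2 / 4 - y / 2 + 1 / 6) := by
  have h := hasSum_one_div_nat_pow_mul_cos one_ne_zero (x := y / 2)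
    ⟨by positivity, by linarith⟩
  -- The frequencies here start at `1`. The dropped term at `0` is `1 / 0 ^ 2 * _ = 0`.
  rw [← hasSum_nat_add_iff' 1] at h
  have h' := h.mul_left (1 / Real.pi ^ 2)
  have hb : Polynomial.bernoulli 2 =
      Polynomial.X ^ 2 - Polynomial.X + Polynomial.C (1 / 6) := by
    rw [Polynomial.bernoulli_def]
    simp only [Finset.sum_range_succ, Finset.sum_range_zero, bernoulli_two, bernoulli_zero,
      Nat.sub_zero, Nat.sub_self, ← Polynomial.C_mul_X_pow_eq_monomial]
    norm_num
    ring
  have hval : 1 / Real.pi ^ 2 * ((-1) ^ (1 + 1) * (2 * Real.pi) ^ (2 * 1) / 2 /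
      ((2 * 1).factorial : ℝ) * Polynomial.eval (y / 2) (Polynomial.map (algebraMap ℚ ℝ)
        (Polynomial.bernoulli (2 * 1))) - ∑ i ∈ Finset.range 1, 1 / (i : ℝ) ^ (2 * 1) *
          Real.cos (2 * Real.pi * i * (y / 2))) = y ^ 2 / 4 - y / 2 + 1 / 6 := by
    simp [hb]
    field_simp
    ring
  rw [hval] at h'
  refine Eq.mpr (congrArg (HasSum · _) (funext fun k ↦ ?_)) h'
  push_cast
  rw [show 2 * Real.pi * ((k : ℝ) + 1) * (y / 2) = ((k : ℝ) + 1) * Real.pi * y by ring]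
  unfold harmonicEigenvalue
  field_simp

lemma summable_harmonicEigenvalue : Summable harmonicEigenvalue := by
  simpa using (hasSum_harmonicEigenvalue_mul_cos le_rfl zero_le_two).summable

lemma hasSum_harmonicEigenvalue_mul_cos_sub (s t : I) :
    HasSum (fun k : ℕ ↦ harmonicEigenvalue k * Real.cos (((k : ℝ) + 1) * Real.pi * (s - t)))
      (((s : ℝ) - t) ^ 2 / 4 - |(s : ℝ) - t| / 2 + 1 / 6) := by
  have h := hasSum_harmonicEigenvalue_mul_cos (y := |(s : ℝ) - t|) (abs_nonneg _)
    (abs_le.2 ⟨by linarith [s.2.1, t.2.2], by linarith [s.2.2, t.2.1]⟩)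
  rw [sq_abs] at h
  convert h using 3 with k
  rw [← Real.cos_abs, abs_mul, abs_of_nonneg (by positivity : 0 ≤ ((k : ℝ) + 1) * Real.pi)]

lemma hasSum_harmonicEigenvalue_mul_cos_add (s t : I) :
    HasSum (fun k : ℕ ↦ harmonicEigenvalue k * Real.cos (((k : ℝ) + 1) * Real.pi * (s + t)))
      (((s : ℝ) + t) ^ 2 / 4 - (s + t) / 2 + 1 / 6) :=
  hasSum_harmonicEigenvalue_mul_cos (add_nonneg s.2.1 t.2.1) (by linarith [s.2.2, t.2.2])

lemma integral_cos_int_mul_pi (m : ℤ) :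
    ∫ x in (0 : ℝ)..1, Real.cos (m * Real.pi * x) = if m = 0 then 1 else 0 := by
  split_ifs with h
  · simp [h]
  · have hm : (m : ℝ) * Real.pi ≠ 0 := mul_ne_zero (Int.cast_ne_zero.2 h) Real.pi_ne_zero
    rw [intervalIntegral.integral_comp_mul_left (fun x ↦ Real.cos x) hm]
    simp [Real.sin_int_mul_pi]

lemma cosSystem_mul_cosSystem (k l : ℕ) (s t : I) : cosSystem k s * cosSystem l t =
    Real.cos (((k : ℝ) + 1) * Real.pi * s - ((l : ℝ) + 1) * Real.pi * t) +
      Real.cos (((k : ℝ) + 1) * Real.pi * s + ((l : ℝ) + 1) * Real.pi * t) := by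
  have h2 : √(2 : ℝ) * √2 = 2 := Real.mul_self_sqrt zero_le_two
  rw [Real.cos_sub, Real.cos_add, cosSystem, cosSystem]
  linear_combination Real.cos (((k : ℝ) + 1) * Real.pi * s) *
    Real.cos (((l : ℝ) + 1) * Real.pi * t) * h2

lemma sinSystem_mul_sinSystem (k l : ℕ) (s t : I) : sinSystem k s * sinSystem l t =
    Real.cos (((k : ℝ) + 1) * Real.pi * s - ((l : ℝ) + 1) * Real.pi * t) -
      Real.cos (((k : ℝ) + 1) * Real.pi * s + ((l : ℝ) + 1) * Real.pi * t) := by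
  have h2 : √(2 : ℝ) * √2 = 2 := Real.mul_self_sqrt zero_le_two
  rw [Real.cos_sub, Real.cos_add, sinSystem, sinSystem]
  linear_combination Real.sin (((k : ℝ) + 1) * Real.pi * s) *
    Real.sin (((l : ℝ) + 1) * Real.pi * t) * h2

lemma integral_cos_sub (k l : ℕ) : ∫ x in (0 : ℝ)..1,
    Real.cos (((k : ℝ) + 1) * Real.pi * x - ((l : ℝ) + 1) * Real.pi * x) =
      if k = l then 1 else 0 := by
  rw [show (if k = l then (1 : ℝ) else 0) = if (k : ℤ) - l = 0 then 1 else 0 by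
    simp [sub_eq_zero], ← integral_cos_int_mul_pi]
  congr! 3 with x
  push_cast
  ring

lemma integral_cos_add (k l : ℕ) : ∫ x in (0 : ℝ)..1,
    Real.cos (((k : ℝ) + 1) * Real.pi * x + ((l : ℝ) + 1) * Real.pi * x) = 0 := by
  have h := integral_cos_int_mul_pi (k + l + 2)
  rw [if_neg (by positivity)] at h
  rw [← h]
  congr! 3 with x
  push_cast
  ring

lemma min_eq_add_sub_abs (s t : ℝ) : min s t = (s + t) / 2 - |s - t| / 2 := by
  rcases le_total s t with h | h
  · rw [min_eq_left h, abs_of_nonpos (by linarith)]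
    ring
  · rw [min_eq_right h, abs_of_nonneg (by linarith)]
    ring

/-- `eₖ(s) eₖ(t) = cos kπ(s - t) + cos kπ(s + t)`, so the kernel is a sum of two values of the
Bernoulli series; the absolute value comes from `min s t = (s + t)/2 - |s - t|/2`. -/
lemma isMercer_cosSystem : IsMercer centeredKernel harmonicEigenvalue cosSystem where
  continuous k := by unfold cosSystem; fun_prop
  sq_le k t := by
    rw [cosSystem, mul_pow, Real.sq_sqrt zero_le_two]
    linarith [Real.cos_sq_le_one (((k : ℝ) + 1) * Real.pi * t)]
  orthonormal k l := by
    simp_rw [cosSystem_mul_cosSystem]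
    rw [integral_unitInterval fun x ↦
      Real.cos (((k : ℝ) + 1) * Real.pi * x - ((l : ℝ) + 1) * Real.pi * x) +
        Real.cos (((k : ℝ) + 1) * Real.pi * x + ((l : ℝ) + 1) * Real.pi * x),
      intervalIntegral.integral_add (Continuous.intervalIntegrable (by fun_prop) _ _)
        (Continuous.intervalIntegrable (by fun_prop) _ _), integral_cos_sub, integral_cos_add,
      add_zero]
  lam_nonneg k := (harmonicEigenvalue_pos k).le
  summable := summable_harmonicEigenvalue
  hasSum s t := by
    simp_rw [cosSystem_mul_cosSystem, mul_add, ← mul_sub, ← mul_add]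
    simp_rw [mul_add (harmonicEigenvalue _)]
    have h := (hasSum_harmonicEigenvalue_mul_cos_sub s t).add
      (hasSum_harmonicEigenvalue_mul_cos_add s t)
    have hK : centeredKernel s t = ((s : ℝ) - t) ^ 2 / 4 - |(s : ℝ) - t| / 2 + 1 / 6 +
        (((s : ℝ) + t) ^ 2 / 4 - (s + t) / 2 + 1 / 6) := by
      rw [centeredKernel, min_eq_add_sub_abs]
      ring
    rwa [← hK] at h

/-- The same two series, now subtracted: the quadratic parts leave `-s t`. The eigenvalues are those
of the cosine case, which is why the two `L²` norms agree in law. -/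
lemma isMercer_sinSystem :
    IsMercer (fun s t ↦ min (s : ℝ) t - s * t) harmonicEigenvalue sinSystem where
  continuous k := by unfold sinSystem; fun_prop
  sq_le k t := by
    rw [sinSystem, mul_pow, Real.sq_sqrt zero_le_two]
    linarith [Real.sin_sq_le_one (((k : ℝ) + 1) * Real.pi * t)]
  orthonormal k l := by
    simp_rw [sinSystem_mul_sinSystem]
    rw [integral_unitInterval fun x ↦
      Real.cos (((k : ℝ) + 1) * Real.pi * x - ((l : ℝ) + 1) * Real.pi * x) -
        Real.cos (((k : ℝ) + 1) * Real.pi * x + ((l : ℝ) + 1) * Real.pi * x),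
      intervalIntegral.integral_sub (Continuous.intervalIntegrable (by fun_prop) _ _)
        (Continuous.intervalIntegrable (by fun_prop) _ _), integral_cos_sub, integral_cos_add,
      sub_zero]
  lam_nonneg k := (harmonicEigenvalue_pos k).le
  summable := summable_harmonicEigenvalue
  hasSum s t := by
    simp_rw [sinSystem_mul_sinSystem, ← mul_sub, ← mul_add]
    simp_rw [mul_sub (harmonicEigenvalue _)]
    have h := (hasSum_harmonicEigenvalue_mul_cos_sub s t).sub
      (hasSum_harmonicEigenvalue_mul_cos_add s t)
    have hK : min (s : ℝ) t - s * t = ((s : ℝ) - t) ^ 2 / 4 - |(s : ℝ) - t| / 2 + 1 / 6 -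
        (((s : ℝ) + t) ^ 2 / 4 - (s + t) / 2 + 1 / 6) := by
      rw [min_eq_add_sub_abs]
      ring
    rwa [← hK] at h

/-! ### Spectrum of an operator with a Mercer kernel -/

namespace IsMercer

variable {K : I → I → ℝ} {lam : ℕ → ℝ} {e : ℕ → I → ℝ}

lemma abs_mul_le (hM : IsMercer K lam e) (k l : ℕ) (s t : I) : |e k s * e l t| ≤ 2 := by
  rw [abs_le]
  constructor <;> nlinarith [hM.sq_le k s, hM.sq_le l t, sq_nonneg (e k s + e l t),
    sq_nonneg (e k s - e l t)]

lemma abs_le (hM : IsMercer K lam e) (k : ℕ) (t : I) : |e k t| ≤ 2 :=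
  abs_le_of_sq_le_sq (by linarith [hM.sq_le k t]) zero_le_two

lemma memLp (hM : IsMercer K lam e) (k : ℕ) : MemLp (e k) 2 volume :=
  MemLp.of_bound (hM.continuous k).aestronglyMeasurable 2 (ae_of_all _ (hM.abs_le k))

lemma integrable_mul (hM : IsMercer K lam e) {h : I → ℝ} (hh : Integrable h) (k : ℕ) :
    Integrable fun s ↦ h s * e k s :=
  hh.mul_bdd (c := 2) (hM.continuous k).aestronglyMeasurable (ae_of_all _ (hM.abs_le k))

lemma abs_integral_mul_le (hM : IsMercer K lam e) {h : I → ℝ} (hh : Integrable h) (k : ℕ) :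
    |∫ s, h s * e k s| ≤ (∫ s, |h s|) * 2 := by
  rw [← integral_mul_const, ← Real.norm_eq_abs]
  refine norm_integral_le_of_norm_le (hh.abs.mul_const 2) (ae_of_all _ fun s ↦ ?_)
  rw [Real.norm_eq_abs, abs_mul]
  exact mul_le_mul_of_nonneg_left (hM.abs_le k s) (abs_nonneg _)

/-- The Fredholm operator is diagonal in the system `e`. -/
lemma hasSum_fredholm (hM : IsMercer K lam e) {h : I → ℝ} (hh : Integrable h) (t : I) :
    HasSum (fun k ↦ lam k * (∫ s, h s * e k s) * e k t) (fredholm K h t) := by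
  have key := hasSum_integral_of_summable_integral_norm (μ := (volume : Measure I))
    (F := fun k s ↦ lam k * e k t * (h s * e k s))
    (fun k ↦ (hM.integrable_mul hh k).const_mul _) ?_
  · have h1 (k : ℕ) : ∫ s, lam k * e k t * (h s * e k s) =
        lam k * (∫ s, h s * e k s) * e k t := by
      rw [integral_const_mul]; ring
    have h2 (s : I) : ∑' k, lam k * e k t * (h s * e k s) = K s t * h s := by
      rw [← (hM.hasSum s t).tsum_eq, ← tsum_mul_right]
      congr 1 with k
      ring
    simp_rw [h1, h2] at key
    exact key
  -- Since `|eₖ(s) eₖ(t)| ≤ 2`, the `k`-th term has `L¹` norm at most `2 λₖ ∫ |h|`.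
  · refine Summable.of_nonneg_of_le (fun k ↦ integral_nonneg fun s ↦ norm_nonneg _) (fun k ↦ ?_)
      (hM.summable.mul_right (2 * ∫ s, |h s|))
    rw [← mul_assoc, ← integral_const_mul]
    refine integral_mono ((hM.integrable_mul hh k).const_mul _).norm (hh.abs.const_mul _)
      fun s ↦ ?_
    have h3 : lam k * e k t * (h s * e k s) = lam k * (e k s * e k t) * h s := by ring
    rw [h3, Real.norm_eq_abs, abs_mul, abs_mul, abs_of_nonneg (hM.lam_nonneg k)]
    exact mul_le_mul_of_nonneg_right (mul_le_mul_of_nonneg_left (hM.abs_mul_le k k s t)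
      (hM.lam_nonneg k)) (abs_nonneg _)

/-- Termwise integration of the series for `T h` against `e j`, where orthonormality leaves one
term. It plays the role of the self-adjointness of `T`. -/
lemma integral_fredholm_mul (hM : IsMercer K lam e) {h : I → ℝ} (hh : Integrable h) (j : ℕ) :
    ∫ t, fredholm K h t * e j t = lam j * ∫ s, h s * e j s := by
  have key := hasSum_integral_of_summable_integral_norm (μ := (volume : Measure I))
    (F := fun k t ↦ lam k * (∫ s, h s * e k s) * (e k t * e j t))
    (fun k ↦ (hM.integrable_mul ((hM.memLp k).integrable one_le_two) j).const_mul _) ?_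
  · simp_rw [integral_const_mul, hM.orthonormal] at key
    have h2 (t : I) : ∑' k, lam k * (∫ s, h s * e k s) * (e k t * e j t) =
        fredholm K h t * e j t := by
      rw [← (hM.hasSum_fredholm hh t).tsum_eq, ← tsum_mul_right]
      congr 1 with k
      ring
    simp_rw [h2] at key
    rw [← key.tsum_eq, tsum_eq_single j fun k hk ↦ by simp [hk]]
    simp
  · refine Summable.of_nonneg_of_le (fun k ↦ integral_nonneg fun s ↦ norm_nonneg _) (fun k ↦ ?_)
      (hM.summable.mul_right ((∫ s, |h s|) * 2 * 2))
    refine (integral_mono_of_nonneg (ae_of_all _ fun t ↦ norm_nonneg _)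
      (integrable_const (lam k * ((∫ s, |h s|) * 2 * 2))) (ae_of_all _ fun t ↦ ?_)).trans_eq
      (by simp)
    simp only [Real.norm_eq_abs]
    rw [abs_mul, abs_mul, abs_of_nonneg (hM.lam_nonneg k), mul_assoc]
    gcongr
    · exact hM.lam_nonneg k
    · exact hM.abs_integral_mul_le hh k
    · exact hM.abs_mul_le k j t t

lemma fredholm_apply (hM : IsMercer K lam e) (j : ℕ) (t : I) :
    fredholm K (e j) t = lam j * e j t := by
  have h := hM.hasSum_fredholm ((hM.memLp j).integrable one_le_two) t
  simp_rw [hM.orthonormal] at h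
  rw [← h.tsum_eq, tsum_eq_single j fun k hk ↦ by simp [hk.symm]]
  simp

lemma isEigenfunction (hM : IsMercer K lam e) (j : ℕ) : IsEigenfunction K (lam j) (e j) where
  memLp := hM.memLp j
  ne_zero h := by
    have h1 := hM.orthonormal j j
    rw [integral_eq_zero_of_ae (h.mono fun t ht ↦ by simp [ht]), if_pos rfl] at h1
    exact zero_ne_one h1
  eigen := ae_of_all _ (hM.fredholm_apply j)

/-- If all coefficients of `h` vanish, so does the series for `T h = μ h`. The system need not span
`L²`: the cosines miss the constants, which lie in the kernel of `T`. -/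
lemma exists_integral_ne_zero (hM : IsMercer K lam e) {μ : ℝ} (hμ : μ ≠ 0) {h : I → ℝ}
    (hh : IsEigenfunction K μ h) : ∃ k, ∫ t, h t * e k t ≠ 0 := by
  by_contra! hcon
  refine hh.ne_zero ?_
  filter_upwards [hh.eigen] with t ht
  have h1 := hM.hasSum_fredholm (hh.memLp.integrable one_le_two) t
  simp_rw [hcon] at h1
  simp only [mul_zero, zero_mul] at h1
  rw [h1.unique hasSum_zero] at ht
  exact (mul_eq_zero.1 ht.symm).resolve_left hμ

/-- Pair `T h = μ h` with `e j`. A nonzero coefficient thus forces `μ = lam j`. -/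
lemma eigenvalue_mul_integral (hM : IsMercer K lam e) {μ : ℝ} {h : I → ℝ}
    (hh : IsEigenfunction K μ h) (j : ℕ) :
    μ * ∫ t, h t * e j t = lam j * ∫ t, h t * e j t := by
  rw [← hM.integral_fredholm_mul (hh.memLp.integrable one_le_two) j, ← integral_const_mul]
  refine integral_congr_ae ?_
  filter_upwards [hh.eigen] with t ht
  rw [ht, mul_assoc]

lemma exists_eq_of_isEigenvalue (hM : IsMercer K lam e) {μ : ℝ} (hμ : μ ≠ 0)
    (h : IsEigenvalue K μ) : ∃ k, lam k = μ := by
  obtain ⟨h, hh⟩ := h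
  obtain ⟨k, hk⟩ := hM.exists_integral_ne_zero hμ hh
  exact ⟨k, (mul_right_cancel₀ hk (hM.eigenvalue_mul_integral hh k)).symm⟩

/-- Injectivity of `lam` makes the eigenvalue simple: only the `k`-th coefficient of `h` survives,
and the series for `T h` has a single term. -/
lemma isEigenfunction_iff (hM : IsMercer K lam e) (hlam : Function.Injective lam) {k : ℕ}
    (hk : lam k ≠ 0) (h : I → ℝ) :
    IsEigenfunction K (lam k) h ↔ ∃ a : ℝ, a ≠ 0 ∧ ∀ᵐ t : I, h t = a * e k t := by
  constructor
  · intro hh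
    have hzero (j : ℕ) (hj : j ≠ k) : ∫ t, h t * e j t = 0 := by
      by_contra hne
      exact hj (hlam (mul_right_cancel₀ hne (hM.eigenvalue_mul_integral hh j))).symm
    refine ⟨∫ t, h t * e k t, ?_, ?_⟩
    · obtain ⟨j, hj⟩ := hM.exists_integral_ne_zero hk hh
      rcases eq_or_ne j k with rfl | hjk
      · exact hj
      · exact absurd (hzero j hjk) hj
    · filter_upwards [hh.eigen] with t ht
      have h1 := (hM.hasSum_fredholm (hh.memLp.integrable one_le_two) t).tsum_eq
      rw [tsum_eq_single k fun j hj ↦ by simp [hzero j hj], ht, mul_assoc] at h1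
      exact (mul_left_cancel₀ hk h1).symm
  · rintro ⟨a, ha, hh⟩
    refine ⟨?_, fun h0 ↦ ?_, ?_⟩
    · exact ((hM.memLp k).const_mul a).ae_eq (hh.mono fun t ht ↦ ht.symm)
    · refine (hM.isEigenfunction k).ne_zero ?_
      filter_upwards [hh, h0] with t ht ht0
      rw [ht0] at ht
      exact (mul_eq_zero.1 ht.symm).resolve_left ha
    · filter_upwards [hh] with t ht
      have h1 : fredholm K h t = a * fredholm K (e k) t := by
        rw [fredholm, fredholm, ← integral_const_mul]
        refine integral_congr_ae (hh.mono fun s hs ↦ ?_)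
        simp only [hs]
        ring
      rw [h1, hM.fredholm_apply, ht]
      ring

end IsMercer

/-! ### The Karhunen–Loève series in mean square -/

section L2

variable {Ω : Type*} [MeasurableSpace Ω] {Q : Measure Ω}

lemma norm_sq_toLp {f : Ω → ℝ} (hf : MemLp f 2 Q) : ‖hf.toLp f‖ ^ 2 = ∫ ω, f ω ^ 2 ∂Q := by
  rw [← real_inner_self_eq_norm_sq, L2.inner_def]
  refine integral_congr_ae ?_
  filter_upwards [hf.coeFn_toLp] with ω hω
  simp [hω, pow_two]

lemma dist_toLp_sq {f g : Ω → ℝ} (hf : MemLp f 2 Q) (hg : MemLp g 2 Q) :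
    dist (hf.toLp f) (hg.toLp g) ^ 2 = ∫ ω, (f ω - g ω) ^ 2 ∂Q := by
  rw [dist_eq_norm, ← MemLp.toLp_sub, norm_sq_toLp]
  rfl

lemma tendstoInMeasure_of_tendsto_integral_sq {f : ℕ → Ω → ℝ} {g : Ω → ℝ}
    (hf : ∀ n, MemLp (f n) 2 Q) (hg : MemLp g 2 Q)
    (h : Tendsto (fun n ↦ ∫ ω, (g ω - f n ω) ^ 2 ∂Q) atTop (𝓝 0)) :
    TendstoInMeasure Q f atTop g := by
  have hlim : Tendsto (fun n ↦ (hf n).toLp (f n)) atTop (𝓝 (hg.toLp g)) := by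
    rw [tendsto_iff_dist_tendsto_zero]
    have h' := (Real.continuous_sqrt.tendsto _).comp h
    rw [Real.sqrt_zero] at h'
    refine h'.congr fun n ↦ ?_
    rw [Function.comp_apply, ← dist_toLp_sq hg (hf n), Real.sqrt_sq dist_nonneg, dist_comm]
  exact (tendstoInMeasure_of_tendsto_Lp hlim).congr (fun n ↦ (hf n).coeFn_toLp) hg.coeFn_toLp

end L2

section Series

variable {Ω : Type*} [MeasurableSpace Ω] {Q : Measure Ω} {ξ : ℕ → Ω → ℝ}

/-- Independent standard normal variables form a centered Gaussian process. -/
lemma isCenteredGaussian_of_iIndepFun (hind : iIndepFun ξ Q)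
    (hlaw : ∀ k, HasLaw (ξ k) (gaussianReal 0 1) Q) :
    IsCenteredGaussian ξ (fun k l ↦ if k = l then 1 else 0) Q where
  gaussian := ⟨fun J ↦ iIndepFun.hasGaussianLaw (X := fun (i : J) ↦ ξ i)
    (fun i ↦ (hlaw i).hasGaussianLaw) (hind.precomp Subtype.val_injective)⟩
  mean k := by rw [(hlaw k).integral_eq]; exact integral_id_gaussianReal
  cov k l := by
    have hm (k : ℕ) : ∫ ω, ξ k ω ∂Q = 0 := by
      rw [(hlaw k).integral_eq]; exact integral_id_gaussianReal
    split_ifs with h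
    · subst h
      have h1 := (hlaw k).variance_eq
      rw [variance_of_integral_eq_zero (hlaw k).aemeasurable (hm k), variance_id_gaussianReal] at h1
      simpa [pow_two] using h1
    · have h1 := (hind.indepFun h).integral_mul_eq_mul_integral
        (hlaw k).aemeasurable.aestronglyMeasurable (hlaw l).aemeasurable.aestronglyMeasurable
      simpa [hm] using h1

lemma integral_sq_sum (hξ : IsCenteredGaussian ξ (fun k l ↦ if k = l then 1 else 0) Q)
    (a : ℕ → ℝ) (s : Finset ℕ) :
    ∫ ω, (∑ k ∈ s, a k * ξ k ω) ^ 2 ∂Q = ∑ k ∈ s, a k ^ 2 := by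
  have h := hξ.integral_sum_mul_sum (fun k : s ↦ (k : ℕ)) (fun k ↦ a k) (fun k : s ↦ (k : ℕ))
    (fun k ↦ a k)
  have h1 (ω : Ω) : ∑ k : s, a k * ξ k ω = ∑ k ∈ s, a k * ξ k ω :=
    Finset.sum_coe_sort s fun k ↦ a k * ξ k ω
  simp_rw [h1, ← pow_two] at h
  rw [h, ← Finset.sum_coe_sort s]
  refine Finset.sum_congr rfl fun i _ ↦ ?_
  rw [Finset.sum_eq_single i (fun j _ hj ↦ by simp [Subtype.coe_ne_coe.2 hj.symm]) (by simp)]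
  simp [pow_two]

lemma memLp_sum (hξ : IsCenteredGaussian ξ (fun k l ↦ if k = l then 1 else 0) Q)
    (a : ℕ → ℝ) (s : Finset ℕ) : MemLp (fun ω ↦ ∑ k ∈ s, a k * ξ k ω) 2 Q :=
  memLp_finsetSum s fun k _ ↦ (hξ.memLp k).const_mul (a k)

/-- Orthonormality of `ξ` in `L²` makes the partial sums Cauchy. The explicit tail is kept in order
to obtain a bound uniform in time. -/
lemma exists_meanSquare_sum
    (hξ : IsCenteredGaussian ξ (fun k l ↦ if k = l then 1 else 0) Q)
    {a : ℕ → ℝ} (ha : Summable fun k ↦ a k ^ 2) :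
    ∃ Z : Ω → ℝ, MemLp Z 2 Q ∧ ∀ n, ∫ ω, (Z ω - ∑ k ∈ Finset.range n, a k * ξ k ω) ^ 2 ∂Q ≤
      ∑' k, a (k + n) ^ 2 := by
  have hmem (n : ℕ) := memLp_sum hξ a (Finset.range n)
  let p (n : ℕ) : Lp ℝ 2 Q := (hmem n).toLp _
  have htail (n m : ℕ) (hnm : n ≤ m) : dist (p m) (p n) ^ 2 ≤ ∑' k, a (k + n) ^ 2 := by
    rw [dist_toLp_sq]
    simp_rw [← Finset.sum_Ico_eq_sub _ hnm]
    rw [integral_sq_sum hξ, Finset.sum_Ico_eq_sum_range]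
    simp_rw [add_comm n]
    exact ((summable_nat_add_iff n).2 ha).sum_le_tsum _ fun k _ ↦ sq_nonneg _
  have htend : Tendsto (fun n ↦ ∑' k, a (k + n) ^ 2) atTop (𝓝 0) :=
    tendsto_sum_nat_add fun k ↦ a k ^ 2
  have hcauchy : CauchySeq p := by
    refine cauchySeq_of_le_tendsto_0' (fun n ↦ √(∑' k, a (k + n) ^ 2)) (fun n m hnm ↦ ?_) ?_
    · rw [dist_comm]
      exact Real.le_sqrt_of_sq_le (htail n m hnm)
    · simpa [Function.comp_def] using (Real.continuous_sqrt.tendsto _).comp htend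
  obtain ⟨Z, hZ⟩ := cauchySeq_tendsto_of_complete hcauchy
  refine ⟨Z, Lp.memLp Z, fun n ↦ ?_⟩
  rw [← dist_toLp_sq (Lp.memLp Z) (hmem n), Lp.toLp_coeFn]
  exact le_of_tendsto ((hZ.dist tendsto_const_nhds).pow 2)
    ((eventually_ge_atTop n).mono fun m hm ↦ htail n m hm)

variable {K : I → I → ℝ} {lam : ℕ → ℝ} {e : ℕ → I → ℝ}

lemma IsMercer.sq_coeff_le (hM : IsMercer K lam e) (k : ℕ) (t : I) :
    (√(lam k) * e k t) ^ 2 ≤ lam k * 2 := by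
  rw [mul_pow, Real.sq_sqrt (hM.lam_nonneg k)]
  exact mul_le_mul_of_nonneg_left (hM.sq_le k t) (hM.lam_nonneg k)

lemma IsMercer.summable_sq_coeff (hM : IsMercer K lam e) (t : I) :
    Summable fun k ↦ (√(lam k) * e k t) ^ 2 :=
  Summable.of_nonneg_of_le (fun _ ↦ sq_nonneg _) (fun k ↦ hM.sq_coeff_le k t)
    (hM.summable.mul_right 2)

/-- Each `S t` is chosen separately, so nothing is known about the paths of `S`. The error bound
independent of `t` makes up for this. -/
lemma exists_series (hξ : IsCenteredGaussian ξ (fun k l ↦ if k = l then 1 else 0) Q)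
    (hM : IsMercer K lam e) : ∃ S : I → Ω → ℝ, (∀ t, MemLp (S t) 2 Q) ∧
    ∀ n t, ∫ ω, (S t ω - ∑ k ∈ Finset.range n, √(lam k) * e k t * ξ k ω) ^ 2 ∂Q ≤
      2 * ∑' k, lam (k + n) := by
  choose S hS hSle using fun t ↦ exists_meanSquare_sum hξ (hM.summable_sq_coeff t)
  refine ⟨S, hS, fun n t ↦ (hSle t n).trans ?_⟩
  rw [← tsum_mul_left]
  refine Summable.tsum_le_tsum (fun k ↦ ?_) ((summable_nat_add_iff n).2 (hM.summable_sq_coeff t))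
    (((summable_nat_add_iff n).2 hM.summable).mul_left 2)
  exact (hM.sq_coeff_le _ t).trans_eq (mul_comm _ _)

variable {S : I → Ω → ℝ}

lemma tendsto_integral_sq_sub
    (hSle : ∀ n t, ∫ ω, (S t ω - ∑ k ∈ Finset.range n,
      √(lam k) * e k t * ξ k ω) ^ 2 ∂Q ≤ 2 * ∑' k, lam (k + n))
    (t : I) : Tendsto (fun n ↦
    ∫ ω, (S t ω - ∑ k ∈ Finset.range n, √(lam k) * e k t * ξ k ω) ^ 2 ∂Q) atTop (𝓝 0) := by
  have h := (tendsto_sum_nat_add lam).const_mul 2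
  rw [mul_zero] at h
  exact squeeze_zero (fun n ↦ integral_nonneg fun ω ↦ sq_nonneg _) (fun n ↦ hSle n t) h

lemma isMeanSquareSum_series
    (hξ : IsCenteredGaussian ξ (fun k l ↦ if k = l then 1 else 0) Q)
    (hS : ∀ t, MemLp (S t) 2 Q)
    (hSle : ∀ n t, ∫ ω, (S t ω - ∑ k ∈ Finset.range n,
      √(lam k) * e k t * ξ k ω) ^ 2 ∂Q ≤ 2 * ∑' k, lam (k + n)) :
    IsMeanSquareSum (fun k t ω ↦ ξ k ω * √(lam k) * e k t) S Q := by
  refine ⟨fun k t ↦ ?_, hS, fun t ↦ ?_⟩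
  · convert (hξ.memLp k).mul_const (√(lam k) * e k t) using 1
    ext ω
    ring
  · convert tendsto_integral_sq_sub hSle t using 7
    ring

/-- The partial sums are Gaussian, and their covariances are the partial sums of the Mercer series.
-/
lemma isCenteredGaussian_series
    (hξ : IsCenteredGaussian ξ (fun k l ↦ if k = l then 1 else 0) Q)
    (hM : IsMercer K lam e) (hS : ∀ t, MemLp (S t) 2 Q)
    (hSle : ∀ n t, ∫ ω, (S t ω - ∑ k ∈ Finset.range n,
      √(lam k) * e k t * ξ k ω) ^ 2 ∂Q ≤ 2 * ∑' k, lam (k + n)) : IsCenteredGaussian S K Q := by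
  refine IsCenteredGaussian.of_tendstoInMeasure
    (fun n ↦ hξ.linear (S := I) (ι := fun _ ↦ Finset.range n) (fun _ k ↦ k)
      (fun t k ↦ √(lam k) * e k t)) (fun s t ↦ ?_) (fun t ↦ ?_)
  · refine (hM.hasSum s t).tendsto_sum_nat.congr fun n ↦ ?_
    rw [← Finset.sum_coe_sort (Finset.range n)]
    refine Finset.sum_congr rfl fun i _ ↦ ?_
    rw [Finset.sum_eq_single i (fun j _ hj ↦ by simp [Subtype.coe_ne_coe.2 hj.symm]) (by simp)]
    have := Real.mul_self_sqrt (hM.lam_nonneg i)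
    simp only [if_true]
    linear_combination -(e i s * e i t) * this
  · have h1 (n : ℕ) (ω : Ω) : ∑ k : Finset.range n, √(lam k) * e k t * ξ k ω =
        ∑ k ∈ Finset.range n, √(lam k) * e k t * ξ k ω :=
      Finset.sum_coe_sort (Finset.range n) fun k ↦ √(lam k) * e k t * ξ k ω
    simp_rw [h1]
    exact tendstoInMeasure_of_tendsto_integral_sq (fun n ↦ memLp_sum hξ _ _) (hS t)
      (tendsto_integral_sq_sub hSle t)

end Series

/-! ### The law of the integral of the square -/

section SquareIntegral

variable {Ω : Type*} [MeasurableSpace Ω] {Q : Measure Ω} {ξ : ℕ → Ω → ℝ}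
  {K : I → I → ℝ} {lam : ℕ → ℝ} {e : ℕ → I → ℝ} {S : I → Ω → ℝ}

/-- The expectation of the sum is `∑ λₖ < ∞`, so the sum is almost surely finite. -/
lemma ae_summable_mul_sq (hξ : IsCenteredGaussian ξ (fun k l ↦ if k = l then 1 else 0) Q)
    (hlam : ∀ k, 0 ≤ lam k) (hsum : Summable lam) :
    ∀ᵐ ω ∂Q, Summable fun k ↦ lam k * ξ k ω ^ 2 := by
  have hmeas (k : ℕ) : AEMeasurable (fun ω ↦ ENNReal.ofReal (lam k * ξ k ω ^ 2)) Q :=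
    (((hξ.gaussian.aemeasurable k).pow_const 2).const_mul _).ennreal_ofReal
  have hint (k : ℕ) : ∫⁻ ω, ENNReal.ofReal (lam k * ξ k ω ^ 2) ∂Q = ENNReal.ofReal (lam k) := by
    rw [← ofReal_integral_eq_lintegral_ofReal ((hξ.memLp k).integrable_sq.const_mul _)
      (ae_of_all _ fun ω ↦ mul_nonneg (hlam k) (sq_nonneg _)), integral_const_mul]
    have h := hξ.cov k k
    simp only [← pow_two, if_true] at h
    rw [h, mul_one]
  have hfin : ∫⁻ ω, ∑' k, ENNReal.ofReal (lam k * ξ k ω ^ 2) ∂Q ≠ ⊤ := by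
    rw [lintegral_tsum hmeas]
    simp_rw [hint]
    rw [← ENNReal.ofReal_tsum_of_nonneg hlam hsum]
    exact ENNReal.ofReal_ne_top
  filter_upwards [ae_lt_top' (AEMeasurable.tsum hmeas) hfin] with ω hω
  refine (ENNReal.summable_toReal hω.ne).congr fun k ↦ ?_
  rw [ENNReal.toReal_ofReal (mul_nonneg (hlam k) (sq_nonneg _))]

/-- A double limit in probability: if `Z n N` approximates `Y N` uniformly in `N`, and
`Z n N → R n → R`, then `Y N → R`. -/
lemma tendstoInMeasure_of_uniform_approx {Y : ℕ → Ω → ℝ} {Z : ℕ → ℕ → Ω → ℝ} {R : ℕ → Ω → ℝ}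
    {R' : Ω → ℝ} {η : ℕ → ℝ} (hη : Tendsto η atTop (𝓝 0))
    (hint : ∀ n N, Integrable (fun ω ↦ Y N ω - Z n N ω) Q)
    (hYZ : ∀ n N, ∫ ω, |Y N ω - Z n N ω| ∂Q ≤ η n)
    (hZR : ∀ n, TendstoInMeasure Q (Z n) atTop (R n)) (hR : TendstoInMeasure Q R atTop R') :
    TendstoInMeasure Q Y atTop R' := by
  rw [tendstoInMeasure_iff_dist]
  intro ε hε
  have hε3 : 0 < ε / 3 := by positivity
  have hmarkov (n N : ℕ) : Q {ω | ε / 3 ≤ dist (Y N ω) (Z n N ω)} ≤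
      ENNReal.ofReal (η n / (ε / 3)) := by
    have h := meas_ge_le_lintegral_div (μ := Q) (f := fun ω ↦ ENNReal.ofReal |Y N ω - Z n N ω|)
      (hint n N).abs.aemeasurable.ennreal_ofReal
      (ENNReal.ofReal_pos.2 hε3).ne' ENNReal.ofReal_ne_top
    rw [← ofReal_integral_eq_lintegral_ofReal (hint n N).abs (ae_of_all _ fun ω ↦ abs_nonneg _),
      ← ENNReal.ofReal_div_of_pos hε3] at h
    refine (measure_mono fun ω hω ↦ ?_).trans (h.trans (ENNReal.ofReal_le_ofReal ?_))
    · exact ENNReal.ofReal_le_ofReal hω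
    · gcongr
      exact hYZ n N
  have hη' : Tendsto (fun n ↦ ENNReal.ofReal (η n / (ε / 3))) atTop (𝓝 0) := by
    simpa [Function.comp_def] using
      (ENNReal.continuous_ofReal.tendsto _).comp (hη.div_const (ε / 3))
  have hR' := tendstoInMeasure_iff_dist.1 hR (ε / 3) hε3
  rw [ENNReal.tendsto_atTop_zero]
  intro δ hδ
  have hδ3 : 0 < δ / 3 := ENNReal.div_pos hδ.ne' (by simp)
  -- The truncation `n` is fixed first, its error being uniform in `N`; only then is `N0` chosen,
  -- depending on `n`.
  obtain ⟨n, hn1, hn2⟩ := ((hη'.eventually_le_const hδ3).and (hR'.eventually_le_const hδ3)).exists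
  obtain ⟨N0, hN0⟩ := eventually_atTop.1
    ((tendstoInMeasure_iff_dist.1 (hZR n) (ε / 3) hε3).eventually_le_const hδ3)
  refine ⟨N0, fun N hN ↦ ?_⟩
  calc Q {ω | ε ≤ dist (Y N ω) (R' ω)}
      ≤ Q ({ω | ε / 3 ≤ dist (Y N ω) (Z n N ω)} ∪ ({ω | ε / 3 ≤ dist (Z n N ω) (R n ω)} ∪
          {ω | ε / 3 ≤ dist (R n ω) (R' ω)})) := by
        refine measure_mono fun ω hω ↦ ?_
        by_contra hcon
        simp only [Set.mem_union, Set.mem_ofPred_eq, not_or, not_le] at hcon hω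
        linarith [dist_triangle4 (Y N ω) (Z n N ω) (R n ω) (R' ω)]
    _ ≤ δ / 3 + (δ / 3 + δ / 3) :=
        (measure_union_le _ _).trans (add_le_add ((hmarkov n N).trans hn1)
          ((measure_union_le _ _).trans (add_le_add (hN0 N hN) hn2)))
    _ = δ := by rw [← add_assoc, ENNReal.add_thirds]

/-- From `f² - g² = (f - g)² + 2(f - g)g` and `2|(f - g)g| ≤ (f - g)²/δ + δ g²`. -/
lemma integral_abs_sq_sub_sq_le {f g : Ω → ℝ} (hf : MemLp f 2 Q) (hg : MemLp g 2 Q) {δ : ℝ}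
    (hδ : 0 < δ) : ∫ ω, |f ω ^ 2 - g ω ^ 2| ∂Q ≤
      (1 + 1 / δ) * ∫ ω, (f ω - g ω) ^ 2 ∂Q + δ * ∫ ω, g ω ^ 2 ∂Q := by
  have hi1 : Integrable (fun ω ↦ (f ω - g ω) ^ 2) Q := (hf.sub hg).integrable_sq
  rw [← integral_const_mul, ← integral_const_mul,
    ← integral_add (hi1.const_mul _) (hg.integrable_sq.const_mul _)]
  refine integral_mono (hf.integrable_sq.sub hg.integrable_sq).abs
    ((hi1.const_mul _).add (hg.integrable_sq.const_mul _)) fun ω ↦ ?_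
  have h1 : 0 ≤ 1 / δ * (f ω - g ω - δ * g ω) ^ 2 := by positivity
  have h2 : 0 ≤ 1 / δ * (f ω - g ω + δ * g ω) ^ 2 := by positivity
  have e1 : 1 / δ * (f ω - g ω - δ * g ω) ^ 2 =
      1 / δ * (f ω - g ω) ^ 2 - 2 * (f ω - g ω) * g ω + δ * g ω ^ 2 := by field_simp; ring
  have e2 : 1 / δ * (f ω - g ω + δ * g ω) ^ 2 =
      1 / δ * (f ω - g ω) ^ 2 + 2 * (f ω - g ω) * g ω + δ * g ω ^ 2 := by field_simp; ring
  beta_reduce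
  rw [abs_le]
  constructor <;> nlinarith [sq_nonneg (f ω - g ω)]

/-- The integral of the square of a partial sum of the series. -/
lemma IsMercer.integral_sq_sum_mul (hM : IsMercer K lam e) (x : ℕ → ℝ) (n : ℕ) :
    ∫ t, (∑ k ∈ Finset.range n, √(lam k) * e k t * x k) ^ 2 =
      ∑ k ∈ Finset.range n, lam k * x k ^ 2 := by
  have h (t : I) : (∑ k ∈ Finset.range n, √(lam k) * e k t * x k) ^ 2 =
      ∑ k ∈ Finset.range n, ∑ l ∈ Finset.range n,
        √(lam k) * x k * (√(lam l) * x l) * (e k t * e l t) := by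
    rw [pow_two, Finset.sum_mul_sum]
    exact Finset.sum_congr rfl fun k _ ↦ Finset.sum_congr rfl fun l _ ↦ by ring
  have hint (k l : ℕ) : Integrable fun t ↦ e k t * e l t :=
    hM.integrable_mul ((hM.memLp k).integrable one_le_two) l
  simp_rw [h]
  rw [integral_finsetSum _ fun k _ ↦ integrable_finsetSum _ fun l _ ↦ (hint k l).const_mul _]
  refine Finset.sum_congr rfl fun k hk ↦ ?_
  rw [integral_finsetSum _ fun l _ ↦ (hint k l).const_mul _]
  simp_rw [integral_const_mul, hM.orthonormal]
  rw [Finset.sum_eq_single k (fun l _ hl ↦ by simp [hl.symm]) (fun h ↦ absurd hk h), if_pos rfl]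
  linear_combination x k ^ 2 * Real.mul_self_sqrt (hM.lam_nonneg k)

/-- Truncate the series at `n`: the error is uniform over all quadratures, and the truncated process
is continuous in `t`, with square integral `∑_{k<n} λₖ ξₖ²` by Parseval. -/
lemma tendstoInMeasure_quadrature_sq
    (hξ : IsCenteredGaussian ξ (fun k l ↦ if k = l then 1 else 0) Q)
    (hM : IsMercer K lam e) (hS : ∀ t, MemLp (S t) 2 Q)
    (hSle : ∀ n t, ∫ ω, (S t ω - ∑ k ∈ Finset.range n,
      √(lam k) * e k t * ξ k ω) ^ 2 ∂Q ≤ 2 * ∑' k, lam (k + n)) :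
    TendstoInMeasure Q (fun N ω ↦ quadrature N fun t ↦ S t ω ^ 2) atTop
      (fun ω ↦ ∑' k, lam k * ξ k ω ^ 2) := by
  have := hξ.gaussian.isProbabilityMeasure
  let p (n : ℕ) (t : I) (ω : Ω) : ℝ := ∑ k ∈ Finset.range n, √(lam k) * e k t * ξ k ω
  have hp (n : ℕ) (t : I) : MemLp (p n t) 2 Q := memLp_sum hξ _ _
  -- The summand `1 / (n + 1)` keeps `r n` positive even if the tail vanishes, so that `δ = √(r n)`
  -- is allowed below.
  let r (n : ℕ) : ℝ := (∑' k, lam (k + n)) + 1 / ((n : ℝ) + 1)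
  have hr (n : ℕ) : 0 < r n :=
    add_pos_of_nonneg_of_pos (tsum_nonneg fun k ↦ hM.lam_nonneg _) (by positivity)
  have hrlim : Tendsto r atTop (𝓝 0) := by
    simpa [r] using (tendsto_sum_nat_add lam).add tendsto_one_div_add_atTop_nhds_zero_nat
  have hsqrt : Tendsto (fun n ↦ √(r n)) atTop (𝓝 0) := by
    simpa [Function.comp_def] using (Real.continuous_sqrt.tendsto _).comp hrlim
  have hp2 (n : ℕ) (t : I) : ∫ ω, p n t ω ^ 2 ∂Q ≤ 2 * ∑' k, lam k := by
    rw [integral_sq_sum hξ, mul_comm, ← tsum_mul_right]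
    exact (Finset.sum_le_sum fun k _ ↦ hM.sq_coeff_le k t).trans
      ((hM.summable.mul_right 2).sum_le_tsum _ fun k _ ↦ mul_nonneg (hM.lam_nonneg k) zero_le_two)
  have hdiff (n : ℕ) (t : I) : ∫ ω, |S t ω ^ 2 - p n t ω ^ 2| ∂Q ≤
      2 * r n + 2 * √(r n) + √(r n) * (2 * ∑' k, lam k) := by
    refine (integral_abs_sq_sub_sq_le (hS t) (hp n t) (Real.sqrt_pos.2 (hr n))).trans ?_
    have h1 : ∫ ω, (S t ω - p n t ω) ^ 2 ∂Q ≤ 2 * r n :=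
      (hSle n t).trans (mul_le_mul_of_nonneg_left
        (le_add_of_nonneg_right (by positivity)) zero_le_two)
    have h2 : 0 < √(r n) := Real.sqrt_pos.2 (hr n)
    have h3 : (1 + 1 / √(r n)) * (2 * r n) = 2 * r n + 2 * √(r n) := by
      linear_combination 2 * Real.div_sqrt (x := r n)
    rw [← h3]
    exact add_le_add (mul_le_mul_of_nonneg_left h1 (by positivity))
      (mul_le_mul_of_nonneg_left (hp2 n t) h2.le)
  have hint (n : ℕ) (t : I) : Integrable (fun ω ↦ S t ω ^ 2 - p n t ω ^ 2) Q :=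
    (hS t).integrable_sq.sub (hp n t).integrable_sq
  have hsub (n N : ℕ) (ω : Ω) :
      (quadrature N fun t ↦ S t ω ^ 2) - (quadrature N fun t ↦ p n t ω ^ 2) =
      ∑ t ∈ (nodes N).range, weight N t * (S t ω ^ 2 - p n t ω ^ 2) := by
    simp_rw [quadrature, mul_sub, Finset.sum_sub_distrib]
  have hη : Tendsto (fun n ↦ 2 * r n + 2 * √(r n) + √(r n) * (2 * ∑' k, lam k)) atTop (𝓝 0) := by
    simpa using ((hrlim.const_mul 2).add (hsqrt.const_mul 2)).add
      (hsqrt.mul_const (2 * ∑' k, lam k))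
  refine tendstoInMeasure_of_uniform_approx hη
    (Z := fun n N ω ↦ quadrature N fun t ↦ p n t ω ^ 2)
    (R := fun n ω ↦ ∑ k ∈ Finset.range n, lam k * ξ k ω ^ 2)
    (fun n N ↦ ?_) (fun n N ↦ ?_) (fun n ↦ ?_) ?_
  · simp_rw [hsub]
    exact integrable_finsetSum _ fun t _ ↦ (hint n t).const_mul _
  · simp_rw [hsub]
    calc ∫ ω, |∑ t ∈ (nodes N).range, weight N t * (S t ω ^ 2 - p n t ω ^ 2)| ∂Q
        ≤ ∫ ω, ∑ t ∈ (nodes N).range, weight N t * |S t ω ^ 2 - p n t ω ^ 2| ∂Q := by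
          refine integral_mono
            (integrable_finsetSum _ fun t _ ↦ (hint n t).const_mul _).abs
            (integrable_finsetSum _ fun t _ ↦ (hint n t).abs.const_mul _) fun ω ↦ ?_
          refine (Finset.abs_sum_le_sum_abs _ _).trans_eq (Finset.sum_congr rfl fun t _ ↦ ?_)
          rw [abs_mul, abs_of_nonneg (weight_nonneg N t)]
      _ = ∑ t ∈ (nodes N).range, weight N t * ∫ ω, |S t ω ^ 2 - p n t ω ^ 2| ∂Q := by
          rw [integral_finsetSum _ fun t _ ↦ (hint n t).abs.const_mul _]
          simp_rw [integral_const_mul]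
      _ ≤ ∑ t ∈ (nodes N).range, weight N t *
            (2 * r n + 2 * √(r n) + √(r n) * (2 * ∑' k, lam k)) :=
          Finset.sum_le_sum fun t _ ↦ mul_le_mul_of_nonneg_left (hdiff n t) (weight_nonneg N t)
      -- The weights sum to `1`, so the bound at a single time passes to the quadrature, whatever
      -- `N` is.
      _ = _ := by rw [← Finset.sum_mul, sum_weight, one_mul]
  · refine tendstoInMeasure_of_tendsto_ae (fun N ↦ ?_) (ae_of_all _ fun ω ↦ ?_)
    · exact AEMeasurable.aestronglyMeasurable <| Finset.aemeasurable_fun_sum _ fun t _ ↦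
        ((hp n t).aestronglyMeasurable.aemeasurable.pow_const 2).const_mul _
    · rw [← hM.integral_sq_sum_mul]
      refine tendsto_quadrature ((continuous_finsetSum _ fun k _ ↦ ?_).pow 2)
      exact (continuous_const.mul (hM.continuous k)).mul continuous_const
  · refine tendstoInMeasure_of_tendsto_ae (fun n ↦ ?_) ?_
    · exact AEMeasurable.aestronglyMeasurable <| Finset.aemeasurable_fun_sum _ fun k _ ↦
        ((hξ.gaussian.aemeasurable k).pow_const 2).const_mul _
    · filter_upwards [ae_summable_mul_sq hξ hM.lam_nonneg hM.summable] with ω hω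
      exact hω.hasSum.tendsto_sum_nat

lemma identDistrib_of_tendstoInMeasure {Ω' : Type*} [MeasurableSpace Ω'] {P : Measure Ω'}
    [IsProbabilityMeasure P] [IsProbabilityMeasure Q] {Y : ℕ → Ω' → ℝ} {Z : ℕ → Ω → ℝ}
    {Y' : Ω' → ℝ} {Z' : Ω → ℝ} (h : ∀ n, IdentDistrib (Y n) (Z n) P Q)
    (hY : TendstoInMeasure P Y atTop Y') (hZ : TendstoInMeasure Q Z atTop Z') :
    IdentDistrib Y' Z' P Q := by
  have hY1 := hY.tendstoInDistribution fun n ↦ (h n).aemeasurable_fst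
  have hZ1 := hZ.tendstoInDistribution fun n ↦ (h n).aemeasurable_snd
  refine ⟨hY1.aemeasurable_limit, hZ1.aemeasurable_limit, ?_⟩
  have hZ2 := hZ1.tendsto.congr (f₂ := fun n ↦ (⟨P.map (Y n),
    Measure.isProbabilityMeasure_map (h n).aemeasurable_fst⟩ : ProbabilityMeasure ℝ))
    fun n ↦ Subtype.ext (h n).map_eq.symm
  exact congrArg Subtype.val
    (tendsto_nhds_unique (X := ProbabilityMeasure ℝ) hY1.tendsto hZ2)

/-- The law of the integral of the square of a process with continuous paths whose law is that of
the Karhunen-Loève series. -/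
lemma identDistrib_integral_sq {Ω' : Type*} [MeasurableSpace Ω'] {P : Measure Ω'}
    [IsProbabilityMeasure P]
    (hξ : IsCenteredGaussian ξ (fun k l ↦ if k = l then 1 else 0) Q)
    (hM : IsMercer K lam e) {X : I → Ω' → ℝ} (hX : IsCenteredGaussian X K P)
    (hcont : ∀ᵐ ω ∂P, Continuous (X · ω)) :
    IdentDistrib (fun ω ↦ ∫ t, X t ω ^ 2) (fun ω ↦ ∑' k, lam k * ξ k ω ^ 2) P Q := by
  have := hξ.gaussian.isProbabilityMeasure
  obtain ⟨S, hS, hSle⟩ := exists_series hξ hM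
  have hXS : EqualInLaw X P S Q := hX.equalInLaw (isCenteredGaussian_series hξ hM hS hSle)
  refine identDistrib_of_tendstoInMeasure (fun N ↦ ?_) ?_
    (tendstoInMeasure_quadrature_sq hξ hM hS hSle) (Y := fun N ω ↦ quadrature N fun t ↦ X t ω ^ 2)
  -- The quadrature sum is a function of finitely many values, so equality of finite-dimensional
  -- laws suffices.
  · have h := (hXS (nodes N).range).comp
      (u := fun x ↦ ∑ i : (nodes N).range, weight N i * x i ^ 2) (by fun_prop)
    convert h using 1
    · ext ω
      exact (Finset.sum_coe_sort (nodes N).range fun t ↦ weight N t * X t ω ^ 2).symm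
    · ext ω
      exact (Finset.sum_coe_sort (nodes N).range fun t ↦ weight N t * S t ω ^ 2).symm
  · refine tendstoInMeasure_of_tendsto_ae (fun N ↦ ?_) ?_
    · exact AEMeasurable.aestronglyMeasurable <| Finset.aemeasurable_fun_sum _ fun t _ ↦
        ((hX.gaussian.aemeasurable t).pow_const 2).const_mul _
    · filter_upwards [hcont] with ω hω
      exact tendsto_quadrature (hω.pow 2)

end SquareIntegral

/-! ### Assembling the expansion -/

lemma memLp_centeredKernel : MemLp (fun p : I × I ↦ centeredKernel p.1 p.2) 2 volume := by
  have hcont : Continuous fun p : I × I ↦ centeredKernel p.1 p.2 := by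
    unfold centeredKernel
    fun_prop
  obtain ⟨C, hC⟩ := isCompact_univ.exists_bound_of_continuousOn hcont.continuousOn
  exact MemLp.of_bound hcont.aestronglyMeasurable C (ae_of_all _ fun p ↦ hC p (Set.mem_univ _))

lemma covFun_eq {Ω : Type*} [MeasurableSpace Ω] {P : Measure Ω} {X : I → Ω → ℝ} {K : I → I → ℝ}
    (hX : IsCenteredGaussian X K P) : covFun X P = K :=
  funext fun s ↦ funext fun t ↦ hX.cov s t

lemma sqrt_harmonicEigenvalue (k : ℕ) :
    √(harmonicEigenvalue k) = 1 / (((k : ℝ) + 1) * Real.pi) := by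
  rw [harmonicEigenvalue, ← mul_pow, ← one_div_pow, Real.sqrt_sq (by positivity)]

/-- The Karhunen-Loève expansion of a centered Gaussian process with a Mercer covariance. -/
lemma isKLExpansion {Ω Ω' : Type*} [MeasurableSpace Ω] [MeasurableSpace Ω'] {P : Measure Ω}
    {Q : Measure Ω'} {ξ : ℕ → Ω' → ℝ} {X : I → Ω → ℝ} {K : I → I → ℝ} {lam : ℕ → ℝ}
    {e : ℕ → I → ℝ} (hξ : IsCenteredGaussian ξ (fun k l ↦ if k = l then 1 else 0) Q)
    (hM : IsMercer K lam e) (hX : IsCenteredGaussian X K P)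
    (hK : MemLp (fun p : I × I ↦ K p.1 p.2) 2 volume) (hlam : Antitone lam) :
    IsKLExpansion X P lam e ξ Q where
  gaussian := hX.gaussian
  centered := hX.mean
  cov_memLp := by rwa [covFun_eq hX]
  lam_nonneg := hM.lam_nonneg
  lam_antitone := hlam
  memLp := hM.memLp
  orthonormal := hM.orthonormal
  eigen k := by
    rw [covFun_eq hX]
    exact hM.isEigenfunction k
  complete μ hμ h hh := by
    rw [covFun_eq hX] at hh
    exact hM.exists_integral_ne_zero hμ hh
  expansion := by
    obtain ⟨S, hS, hSle⟩ := exists_series hξ hM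
    exact ⟨S, isMeanSquareSum_series hξ hS hSle,
      hX.equalInLaw (isCenteredGaussian_series hξ hM hS hSle)⟩

/-- Gaussianity, means and covariances are all read from finite-dimensional laws. This serves the
bridge, which is given only through its law. -/
lemma IsCenteredGaussian.of_equalInLaw {T Ω Ω' : Type*} [MeasurableSpace Ω] [MeasurableSpace Ω']
    {X : T → Ω → ℝ} {Y : T → Ω' → ℝ} {K : T → T → ℝ} {P : Measure Ω} {Q : Measure Ω'}
    (hY : IsCenteredGaussian Y K Q) (h : EqualInLaw X P Y Q) : IsCenteredGaussian X K P where
  gaussian := ⟨fun J ↦ ⟨by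
    rw [(h J).map_eq]
    exact (hY.gaussian.hasGaussianLaw J).isGaussian_map⟩⟩
  mean t := by
    have h1 := (h {t}).comp (u := fun x : ({t} : Finset T) → ℝ ↦ x ⟨t, by simp⟩) (by fun_prop)
    exact h1.integral_eq.trans (hY.mean t)
  cov s t := by
    classical
    have h1 := (h {s, t}).comp
      (u := fun x : ({s, t} : Finset T) → ℝ ↦ x ⟨s, by simp⟩ * x ⟨t, by simp⟩) (by fun_prop)
    exact h1.integral_eq.trans (hY.cov s t)

end KL

theorem theorem1p1
    {Ω Ω' Ω'' : Type*} [MeasurableSpace Ω] [MeasurableSpace Ω'] [MeasurableSpace Ω'']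
    (P : Measure Ω) (P' : Measure Ω') (Q : Measure Ω'')
    [IsProbabilityMeasure P] [IsProbabilityMeasure P'] [IsProbabilityMeasure Q]
    -- `W` is a standard Wiener process
    (W : ℝ≥0 → Ω → ℝ) (hW : IsBrownianReal W P)
    -- `B` is a standard Brownian bridge
    (B : I → Ω' → ℝ) (hB : KL.EqualInLaw B P' (KL.tiedDown W) P)
    (hBcont : ∀ᵐ ω ∂P', Continuous (B · ω))
    -- `ξ 0, ξ 1, ...` are i.i.d. standard normal variables
    (ξ : ℕ → Ω'' → ℝ) (hξ_indep : iIndepFun ξ Q)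
    (hξ_law : ∀ k, HasLaw (ξ k) (gaussianReal 0 1) Q) :
    -- the Karhunen-Loève expansion
    KL.IsKLExpansion (KL.meanCentered W) P
      (fun k ↦ 1 / (((k : ℝ) + 1) ^ 2 * Real.pi ^ 2))
      (fun k t ↦ √2 * Real.cos (((k : ℝ) + 1) * Real.pi * (t : ℝ))) ξ Q ∧
    -- the same series, written out
    (∃ S : I → Ω'' → ℝ,
      KL.IsMeanSquareSum (fun k t ω ↦ ξ k ω *
        (√2 * Real.cos (((k : ℝ) + 1) * Real.pi * (t : ℝ)) / (((k : ℝ) + 1) * Real.pi))) S Q ∧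
      KL.EqualInLaw (KL.meanCentered W) P S Q) ∧
    -- the nonzero eigenvalues, and the eigenfunctions
    {μ : ℝ | μ ≠ 0 ∧ KL.IsEigenvalue (KL.covFun (KL.meanCentered W) P) μ} =
      Set.range (fun k : ℕ ↦ 1 / (((k : ℝ) + 1) ^ 2 * Real.pi ^ 2)) ∧
    (∀ (k : ℕ) (h : I → ℝ),
      KL.IsEigenfunction (KL.covFun (KL.meanCentered W) P)
        (1 / (((k : ℝ) + 1) ^ 2 * Real.pi ^ 2)) h ↔
      ∃ a : ℝ, a ≠ 0 ∧ ∀ᵐ t : I, h t = a * Real.cos (((k : ℝ) + 1) * Real.pi * (t : ℝ))) ∧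
    -- the law of the `L²` norm
    IdentDistrib (KL.pathL2Norm (KL.meanCentered W)) (KL.pathL2Norm B) P P' ∧
    (∀ᵐ ω ∂Q, Summable (fun k : ℕ ↦ ξ k ω ^ 2 / (((k : ℝ) + 1) ^ 2 * Real.pi ^ 2))) ∧
    IdentDistrib (fun ω ↦ ∫ t : I, KL.meanCentered W t ω ^ 2) (fun ω ↦ ∫ t : I, B t ω ^ 2) P P' ∧
    IdentDistrib (fun ω ↦ ∫ t : I, B t ω ^ 2)
      (fun ω ↦ ∑' k : ℕ, ξ k ω ^ 2 / (((k : ℝ) + 1) ^ 2 * Real.pi ^ 2)) P' Q := by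

  have hξ := KL.isCenteredGaussian_of_iIndepFun hξ_indep hξ_law
  have hM := KL.isMercer_cosSystem
  have hX := KL.isCenteredGaussian_meanCentered hW
  have hBG := (KL.isCenteredGaussian_tiedDown hW).of_equalInLaw hB
  have hXcont : ∀ᵐ ω ∂P, Continuous (KL.meanCentered W · ω) := by
    filter_upwards [hW.cont] with ω hω
    unfold KL.meanCentered
    fun_prop
  have hKL := KL.isKLExpansion hξ hM hX KL.memLp_centeredKernel
    KL.strictAnti_harmonicEigenvalue.antitone
  have hterm (k : ℕ) (x : ℝ) : KL.harmonicEigenvalue k * x ^ 2 =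
      x ^ 2 / (((k : ℝ) + 1) ^ 2 * Real.pi ^ 2) := by
    rw [KL.harmonicEigenvalue]
    ring
  have hXlaw := KL.identDistrib_integral_sq hξ hM hX hXcont
  have hBlaw := KL.identDistrib_integral_sq hξ KL.isMercer_sinSystem hBG hBcont
  -- Both integrals have the law of the same variable `∑ λₖ ξₖ²`.
  have hXB := hXlaw.trans hBlaw.symm
  have hsum := KL.ae_summable_mul_sq hξ hM.lam_nonneg hM.summable
  simp_rw [hterm] at hBlaw hsum
  refine ⟨hKL, ?_, ?_, fun k h ↦ ?_, hXB.comp Real.continuous_sqrt.measurable, hsum, hXB, hBlaw⟩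
  · obtain ⟨S, hS, hlaw⟩ := hKL.expansion
    refine ⟨S, ?_, hlaw⟩
    convert hS using 4 with k t ω
    rw [KL.sqrt_harmonicEigenvalue, KL.cosSystem]
    ring
  · rw [KL.covFun_eq hX]
    ext μ
    constructor
    · rintro ⟨hμ, h⟩
      exact hM.exists_eq_of_isEigenvalue hμ h
    · rintro ⟨k, rfl⟩
      exact ⟨(KL.harmonicEigenvalue_pos k).ne', _, hM.isEigenfunction k⟩
  · rw [KL.covFun_eq hX]
    refine (hM.isEigenfunction_iff KL.strictAnti_harmonicEigenvalue.injective
      (KL.harmonicEigenvalue_pos k).ne' h).trans ⟨?_, ?_⟩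
    · rintro ⟨a, ha, hh⟩
      -- The normalization `√2` of the system is absorbed into the free constant.
      refine ⟨a * √2, by positivity, hh.mono fun t ht ↦ ?_⟩
      rw [ht, KL.cosSystem]
      ring
    · rintro ⟨a, ha, hh⟩
      refine ⟨a / √2, by positivity, hh.mono fun t ht ↦ ?_⟩
      rw [ht, KL.cosSystem]
      field_simp
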